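/- Let $\mathbb D=\{z\in\mathbb C:|z|<1\}$, let $n\ge 0$ be an integer, $\alpha>-1$ a real number, and $q=(q_1,\dots,q_n)$ a multi-index of integers $q_j\ge 1$ (for instance $q_1=\dots=q_n$). A function $f:\mathbb D^n\to\mathbb C$ is called $q$-analytic if it is of class $C^{q_1+\cdots+q_n}$ and $\partial^{q_j}f/\partial\bar z_j^{\,q_j}=0$ on $\mathbb D^n$ for every $j$; a $q$-analytic polynomial is a polynomial in $z_1,\dots,z_n,\bar z_1,\dots,\bar z_n$ which is $q$-analytic. Let $d\nu_{\alpha,n}(z)=\pi^{-n}\prod_{j=1}^n(1-|z_j|^2)^\alpha\,dV(z)$ on $\mathbb D^n$, where $dV$ is Lebesgue measure, and let $\mathcal A^2_{\alpha,n,q}$ be the space of $q$-analytic functions on $\mathbb D^n$ that are square integrable with respect to $\nu_{\alpha,n}$, with the inner product of $L^2(\nu_{\alpha,n})$. A function $K$ on $\mathbb D^n\times\mathbb D^n$ is the reproducing kernel of this space if, for every $w\in\mathbb D^n$, $K(\cdot,w)\in\mathcal A^2_{\alpha,n,q}$ and $f(w)=\int f(z)\overline{K(z,w)}\,d\nu_{\alpha,n}(z)$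 for all $f\in\mathcal A^2_{\alpha,n,q}$. For an integer $m\ge1$ let $\mathcal A^2_{\alpha,m}$ be the corresponding one-variable space: the functions $f$ of class $C^m$ on $\mathbb D$ with $\partial^m f/\partial\bar z^m=0$ that are square integrable with respect to $\frac1\pi(1-|z|^2)^\alpha dA(z)$. Then $\mathcal A^2_{\alpha,n,q}$ is a Hilbert space, and it coincides with the closure of the $q$-analytic polynomials in $L^2(\nu_{\alpha,n})$. For each $j$ the one-variable space $\mathcal A^2_{\alpha,q_j}$ has a reproducing kernel $K_{\alpha,q_j}$ (the weighted polyanalytic Bergman kernel of the unit disc), and $\mathcal A^2_{\alpha,n,q}$ has a unique reproducing kernel, given by $$K_{\alpha,n,q}(z,w)=\prod_{j=1}^n K_{\alpha,q_j}(z_j,w_j),\qquad z,w\in\mathbb D^n.$$ -/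

import Mathlib

open MeasureTheory

noncomputable section

namespace PolyBergman

/-- `K` is the reproducing kernel, on the domain `Ω`, of the space `A` of functions that are
square integrable with respect to `ν`, for the inner product inherited from `L²(ν)`:
every `K(·, w)` belongs to the space and `f w = ⟨f, K(·, w)⟩` for every `f` in the space. -/
def IsReproducingKernel {X : Type*} [MeasurableSpace X] (ν : Measure X) (Ω : Set X)
    (A : Set (X → ℂ)) (K : X → X → ℂ) : Prop :=
  ∀ w ∈ Ω, (fun z => K z w) ∈ A ∧
    ∀ f ∈ A, f w = ∫ z, f z * (starRingEnd ℂ) (K z w) ∂ν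

/-! ### One variable: the unit disc -/

/-- The operator `∂/∂z̄ = (∂/∂x + i ∂/∂y) / 2` in one complex variable. -/
def discDbar (f : ℂ → ℂ) (z : ℂ) : ℂ :=
  (1 / 2 : ℂ) * (fderiv ℝ f z 1 + Complex.I * fderiv ℝ f z Complex.I)

/-- The open unit disc. -/
def disc : Set ℂ := {z | ‖z‖ < 1}

/-- `f` is polyanalytic of order `q` in the unit disc. -/
def IsDiscPolyanalytic (q : ℕ) (f : ℂ → ℂ) : Prop :=
  ContDiffOn ℝ q f disc ∧ ∀ z ∈ disc, (discDbar^[q]) f z = 0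

/-- The measure `(1 - |z|²)^α dA(z) / π` on the unit disc. -/
def discMeasure (α : ℝ) : Measure ℂ :=
  (volume.restrict disc).withDensity
    (fun z => ENNReal.ofReal ((1 / Real.pi) * (1 - ‖z‖ ^ 2) ^ α))

/-- The weighted polyanalytic Bergman space of the unit disc, as a set of functions
(values off the disc are irrelevant). -/
def discBergman (α : ℝ) (q : ℕ) : Set (ℂ → ℂ) :=
  {f | IsDiscPolyanalytic q f ∧ MemLp f 2 (discMeasure α)}

/-- `K` is the weighted polyanalytic Bergman kernel of the unit disc. -/
def IsDiscBergmanKernel (α : ℝ) (q : ℕ) (K : ℂ → ℂ → ℂ) : Prop :=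
  IsReproducingKernel (discMeasure α) disc (discBergman α q) K

/-! ### Several variables: the unit polydisc -/

variable {n : ℕ}

/-- The operator `∂/∂z̄ⱼ = (∂/∂xⱼ + i ∂/∂yⱼ) / 2` on functions of `n` complex variables. -/
def dbar (j : Fin n) (f : (Fin n → ℂ) → ℂ) (z : Fin n → ℂ) : ℂ :=
  (1 / 2 : ℂ) *
    (fderiv ℝ f z (Pi.single j 1) + Complex.I * fderiv ℝ f z (Pi.single j Complex.I))

/-- The open unit polydisc. -/
def polydisc (n : ℕ) : Set (Fin n → ℂ) := {z | ∀ j, ‖z j‖ < 1}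

/-- `f` is polyanalytic of order `q = (q₁, …, qₙ)` in the unit polydisc:
`∂^{qⱼ} f / ∂z̄ⱼ^{qⱼ} = 0` for every `j`. -/
def IsPolyanalytic (q : Fin n → ℕ) (f : (Fin n → ℂ) → ℂ) : Prop :=
  ContDiffOn ℝ ((∑ j, q j : ℕ) : WithTop ℕ∞) f (polydisc n) ∧
    ∀ j, ∀ z ∈ polydisc n, ((dbar j)^[q j]) f z = 0

/-- The measure `π⁻ⁿ ∏ⱼ (1 - |zⱼ|²)^α dV(z)` on the unit polydisc. -/
def polydiscMeasure (n : ℕ) (α : ℝ) : Measure (Fin n → ℂ) :=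
  (volume.restrict (polydisc n)).withDensity
    (fun z => ENNReal.ofReal ((1 / Real.pi ^ n) * ∏ j, (1 - ‖z j‖ ^ 2) ^ α))

theorem isOpen_polydisc : IsOpen (polydisc n) := by
  have : polydisc n = ⋂ j, {z : Fin n → ℂ | ‖z j‖ < 1} := by
    ext z; simp [polydisc]
  rw [this]
  exact isOpen_iInter_of_finite fun j =>
    isOpen_lt (continuous_norm.comp (continuous_apply j)) continuous_const

theorem contDiffOn_dbar {m : ℕ} {f : (Fin n → ℂ) → ℂ} (j : Fin n)
    (hf : ContDiffOn ℝ (m + 1 : ℕ) f (polydisc n)) :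
    ContDiffOn ℝ m (dbar j f) (polydisc n) := by
  have h : ContDiffOn ℝ m (fderiv ℝ f) (polydisc n) :=
    hf.fderiv_of_isOpen isOpen_polydisc (by push_cast; exact le_rfl)
  exact contDiffOn_const.mul ((h.clm_apply contDiffOn_const).add
    (contDiffOn_const.mul (h.clm_apply contDiffOn_const)))

theorem dbar_congr {f g : (Fin n → ℂ) → ℂ} (j : Fin n) (h : Set.EqOn f g (polydisc n)) :
    Set.EqOn (dbar j f) (dbar j g) (polydisc n) := by
  intro z hz
  have : f =ᶠ[nhds z] g := h.eventuallyEq_of_mem (isOpen_polydisc.mem_nhds hz)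
  simp only [dbar, this.fderiv_eq]

theorem dbar_iterate_congr (j : Fin n) (k : ℕ) : ∀ {f g : (Fin n → ℂ) → ℂ},
    Set.EqOn f g (polydisc n) →
      Set.EqOn ((dbar j)^[k] f) ((dbar j)^[k] g) (polydisc n) := by
  induction k with
  | zero => intro f g h; exact h
  | succ k ih => intro f g h; exact ih (dbar_congr j h)

theorem dbar_iterate_linear (j : Fin n) (a : ℂ) (k : ℕ) : ∀ {f g : (Fin n → ℂ) → ℂ},
    ContDiffOn ℝ k f (polydisc n) → ContDiffOn ℝ k g (polydisc n) →
      Set.EqOn ((dbar j)^[k] (a • f + g)) (a • (dbar j)^[k] f + (dbar j)^[k] g)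
        (polydisc n) := by
  induction k with
  | zero => intro f g _ _ z _; rfl
  | succ k ih =>
    intro f g hf hg
    have h1 : Set.EqOn (dbar j (a • f + g)) (a • dbar j f + dbar j g) (polydisc n) := by
      intro z hz
      have hfz : DifferentiableAt ℝ f z :=
        (hf.differentiableOn (by simp)).differentiableAt (isOpen_polydisc.mem_nhds hz)
      have hgz : DifferentiableAt ℝ g z :=
        (hg.differentiableOn (by simp)).differentiableAt (isOpen_polydisc.mem_nhds hz)
      simp only [dbar, Pi.add_apply, Pi.smul_apply, fderiv_add (hfz.const_smul a) hgz,
        fderiv_const_smul hfz a, ContinuousLinearMap.add_apply, ContinuousLinearMap.smul_apply,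
        smul_eq_mul]
      ring
    simp only [Function.iterate_succ, Function.comp_apply]
    exact (dbar_iterate_congr j k h1).trans
      (ih (contDiffOn_dbar j hf) (contDiffOn_dbar j hg))

theorem dbar_zero (j : Fin n) : dbar j (0 : (Fin n → ℂ) → ℂ) = 0 := by
  funext z
  simp [dbar]

theorem IsPolyanalytic.zero (q : Fin n → ℕ) : IsPolyanalytic q (0 : (Fin n → ℂ) → ℂ) := by
  refine ⟨contDiffOn_const, fun j z _ => ?_⟩
  rw [Function.iterate_fixed (dbar_zero j)]
  rfl

theorem IsPolyanalytic.smul_add {q : Fin n → ℕ} {f g : (Fin n → ℂ) → ℂ} (a : ℂ)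
    (hf : IsPolyanalytic q f) (hg : IsPolyanalytic q g) : IsPolyanalytic q (a • f + g) := by
  refine ⟨(contDiffOn_const.smul hf.1).add hg.1, fun j z hz => ?_⟩
  have hle : ((q j : ℕ) : WithTop ℕ∞) ≤ ((∑ j, q j : ℕ) : WithTop ℕ∞) := by
    exact_mod_cast Finset.single_le_sum (fun i _ => Nat.zero_le (q i)) (Finset.mem_univ j)
  rw [dbar_iterate_linear j a (q j) (hf.1.of_le hle) (hg.1.of_le hle) hz]
  simp [hf.2 j z hz, hg.2 j z hz]

/-- The weighted polyanalytic Bergman space of the unit polydisc, as a space of functions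
(values off the polydisc are irrelevant). -/
def bergman (α : ℝ) (q : Fin n → ℕ) : Submodule ℂ ((Fin n → ℂ) → ℂ) where
  carrier := {f | IsPolyanalytic q f ∧ MemLp f 2 (polydiscMeasure n α)}
  zero_mem' := ⟨IsPolyanalytic.zero q, MemLp.zero⟩
  add_mem' := by
    rintro f g ⟨hf, hf'⟩ ⟨hg, hg'⟩
    refine ⟨?_, hf'.add hg'⟩
    simpa using hf.smul_add 1 hg
  smul_mem' := by
    rintro a f ⟨hf, hf'⟩
    refine ⟨?_, hf'.const_smul a⟩
    simpa using hf.smul_add a (IsPolyanalytic.zero q)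

/-- The weighted polyanalytic Bergman space as a subspace of `L²`, with the inherited
inner product. -/
def bergmanL2 (α : ℝ) (q : Fin n → ℕ) : Submodule ℂ (Lp ℂ 2 (polydiscMeasure n α)) where
  carrier := {F | ∃ f ∈ bergman α q, F =ᵐ[polydiscMeasure n α] f}
  zero_mem' := ⟨0, Submodule.zero_mem _, Lp.coeFn_zero _ _ _⟩
  add_mem' := by
    rintro F G ⟨f, hf, hF⟩ ⟨g, hg, hG⟩
    exact ⟨f + g, Submodule.add_mem _ hf hg, (Lp.coeFn_add F G).trans (hF.add hG)⟩
  smul_mem' := by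
    rintro a F ⟨f, hf, hF⟩
    exact ⟨a • f, Submodule.smul_mem _ a hf, (Lp.coeFn_smul a F).trans (hF.const_smul a)⟩

/-- `p` is a `q`-analytic polynomial: a polynomial in `z₁, …, zₙ, z̄₁, …, z̄ₙ` that is
polyanalytic of order `q`. -/
def IsPolyanalyticPolynomial (q : Fin n → ℕ) (p : (Fin n → ℂ) → ℂ) : Prop :=
  IsPolyanalytic q p ∧ ∃ P : MvPolynomial (Fin n ⊕ Fin n) ℂ,
    ∀ z, p z = MvPolynomial.eval (Sum.elim z fun j => (starRingEnd ℂ) (z j)) P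

/-- The classes in `L²` of the `q`-analytic polynomials. -/
def polynomialsL2 (α : ℝ) (q : Fin n → ℕ) : Set (Lp ℂ 2 (polydiscMeasure n α)) :=
  {F | ∃ p, IsPolyanalyticPolynomial q p ∧ F =ᵐ[polydiscMeasure n α] p}

/-- `K` is the weighted polyanalytic Bergman kernel of the unit polydisc. -/
def IsBergmanKernel (α : ℝ) (q : Fin n → ℕ)
    (K : (Fin n → ℂ) → (Fin n → ℂ) → ℂ) : Prop :=
  IsReproducingKernel (polydiscMeasure n α) (polydisc n) (bergman α q : Set _) K

end PolyBergman

end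

noncomputable section

namespace PolyBergman

open scoped ContDiff ENNReal
open Complex

/-! In one variable a `q`-analytic function is `∑ k < q, conj (z - w) ^ k * h k z` with `h k`
holomorphic. Integrate it against a smooth radial bump `φ` centred at `w`, small in support, with `∫
|z|^(2k) φ` equal to `1` for `k = 0` and to `0` for `0 < k < q`. Rotation invariance removes the
monomials `z ^ i * conj z ^ j` with `i ≠ j`, the moments remove the rest, and the value at `w`
remains (`IsDiscPolyanalytic.integral_mul_bump`). Slices of polyanalytic functions are polyanalytic,
so this can be iterated by Fubini: a polyanalytic `f` on the polydisc is locally its own convolution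
with a product of bumps.

On compact subsets the weight is bounded below. Hence point evaluations are bounded for the `L²`
norm, and an `L²` limit of members is locally a convolution with a smooth function, on which the
powers of `∂/∂z̄ⱼ` still vanish. So the space is closed (`isClosed_bergmanL2`), and projecting the
evaluation functionals yields kernels. The disc is the case `n = 1`. The product formula is the
iterated Fubini argument again, applied to the one-variable kernels
(`eq_integral_prod_of_separately`), and uniqueness is Hermitian symmetry.

Density on the disc: a member orthogonal to all monomials has vanishing part in every angular
degree, since distinct degrees are orthogonal on concentric discs
(`eq_zero_of_orthogonal_discMonomial`). On the polydisc a member orthogonal to all monomials is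
orthogonal to products of one-variable kernels, which are limits of combinations of monomials, and
the reproducing property makes it vanish pointwise (`bergmanL2_eq_closure`). -/

/-! ### Polyanalytic functions of one variable -/

theorem isOpen_disc : IsOpen disc := isOpen_lt continuous_norm continuous_const

theorem disc_eq_ball : disc = Metric.ball (0 : ℂ) 1 := by
  ext z; simp [disc]

theorem discDbar_congr {f g : ℂ → ℂ} (h : Set.EqOn f g disc) :
    Set.EqOn (discDbar f) (discDbar g) disc := by
  intro z hz
  have : f =ᶠ[nhds z] g := h.eventuallyEq_of_mem (isOpen_disc.mem_nhds hz)
  simp only [discDbar, this.fderiv_eq]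

theorem discDbar_iterate_congr (k : ℕ) {f g : ℂ → ℂ} (h : Set.EqOn f g disc) :
    Set.EqOn (discDbar^[k] f) (discDbar^[k] g) disc := by
  induction k generalizing f g with
  | zero => exact h
  | succ k ih => exact ih (discDbar_congr h)

theorem contDiffOn_discDbar {m : ℕ∞} {f : ℂ → ℂ} (hf : ContDiffOn ℝ (m + 1) f disc) :
    ContDiffOn ℝ m (discDbar f) disc := by
  have h : ContDiffOn ℝ m (fderiv ℝ f) disc := hf.fderiv_of_isOpen isOpen_disc le_rfl
  exact contDiffOn_const.mul ((h.clm_apply contDiffOn_const).add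
    (contDiffOn_const.mul (h.clm_apply contDiffOn_const)))

theorem discDbar_zero : discDbar 0 = 0 := by
  funext z
  simp [discDbar]

theorem discDbar_mul {f g : ℂ → ℂ} {z : ℂ} (hf : DifferentiableAt ℝ f z)
    (hg : DifferentiableAt ℝ g z) :
    discDbar (fun t => f t * g t) z = discDbar f z * g z + f z * discDbar g z := by
  simp only [discDbar, fderiv_fun_mul hf hg, add_apply, smul_apply, smul_eq_mul]
  ring

theorem discDbar_sub {f g : ℂ → ℂ} {z : ℂ} (hf : DifferentiableAt ℝ f z)
    (hg : DifferentiableAt ℝ g z) :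
    discDbar (fun t => f t - g t) z = discDbar f z - discDbar g z := by
  simp only [discDbar, fderiv_fun_sub hf hg, sub_apply]
  ring

theorem discDbar_const_mul (c : ℂ) {f : ℂ → ℂ} {z : ℂ} (hf : DifferentiableAt ℝ f z) :
    discDbar (fun t => c * f t) z = c * discDbar f z := by
  simp only [discDbar, fderiv_const_mul hf, smul_apply, smul_eq_mul]
  ring

theorem discDbar_sum {ι : Type*} (s : Finset ι) {f : ι → ℂ → ℂ} {z : ℂ}
    (hf : ∀ i ∈ s, DifferentiableAt ℝ (f i) z) :
    discDbar (fun t => ∑ i ∈ s, f i t) z = ∑ i ∈ s, discDbar (f i) z := by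
  simp only [discDbar, fderiv_fun_sum hf, FunLike.coe_sum, Finset.sum_apply,
    Finset.mul_sum, Finset.sum_add_distrib, mul_add]

/-- The Cauchy–Riemann criterion: `discDbar f z` is `I / 2` times the defect of complex linearity of
the real derivative. -/
theorem discDbar_eq_zero_iff {f : ℂ → ℂ} {z : ℂ} (hf : DifferentiableAt ℝ f z) :
    discDbar f z = 0 ↔ DifferentiableAt ℂ f z := by
  rw [differentiableAt_complex_iff_differentiableAt_real]
  have : discDbar f z = I / 2 * (fderiv ℝ f z I - I • fderiv ℝ f z 1) := by
    simp only [discDbar, smul_eq_mul]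
    linear_combination (1 / 2 * fderiv ℝ f z 1) * I_mul_I
  rw [this]
  simp [hf, sub_eq_zero]

theorem discDbar_conj_pow_succ (w : ℂ) (k : ℕ) (z : ℂ) :
    discDbar (fun t => (starRingEnd ℂ) (t - w) ^ (k + 1)) z =
      (k + 1) * (starRingEnd ℂ) (z - w) ^ k := by
  have h0 : HasFDerivAt (𝕜 := ℝ) (fun t : ℂ => (starRingEnd ℂ) (t - w))
      conjCLE.toContinuousLinearMap z := by
    have := (conjCLE.toContinuousLinearMap.hasFDerivAt (x := z - w)).comp z
      ((hasFDerivAt_id (𝕜 := ℝ) z).sub_const w)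
    exact this
  have h1 := h0.pow (k + 1)
  simp only [discDbar, h1.fderiv]
  simp
  linear_combination (-(1 / 2) * (k + 1) * (starRingEnd ℂ z - starRingEnd ℂ w) ^ k) * I_mul_I

theorem differentiable_conj_sub_pow (w : ℂ) (k : ℕ) :
    Differentiable ℝ (fun t => (starRingEnd ℂ) (t - w) ^ k) := by
  have : ContDiff ℝ 1 (fun t => (starRingEnd ℂ) (t - w) ^ k) :=
    ((conjCLE.contDiff).comp (contDiff_id.sub contDiff_const)).pow k
  exact this.differentiable one_ne_zero

theorem differentiableAt_real_of_holomorphic {h : ℂ → ℂ} (hh : DifferentiableOn ℂ h disc) {z : ℂ}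
    (hz : z ∈ disc) : DifferentiableAt ℝ h z :=
  (hh.differentiableAt (isOpen_disc.mem_nhds hz)).restrictScalars ℝ

theorem discDbar_conj_pow_succ_mul (w : ℂ) (k : ℕ) {h : ℂ → ℂ} (hh : DifferentiableOn ℂ h disc)
    {z : ℂ} (hz : z ∈ disc) :
    discDbar (fun t => (starRingEnd ℂ) (t - w) ^ (k + 1) * h t) z =
      (k + 1) * (starRingEnd ℂ) (z - w) ^ k * h z := by
  have hd := hh.differentiableAt (isOpen_disc.mem_nhds hz)
  rw [discDbar_mul (differentiable_conj_sub_pow w _ z) (hd.restrictScalars ℝ),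
    discDbar_conj_pow_succ, (discDbar_eq_zero_iff (hd.restrictScalars ℝ)).2 hd]
  ring

/-- Every polyanalytic function is a polynomial in `conj (z - w)` with holomorphic coefficients. -/
theorem IsDiscPolyanalytic.exists_decomposition (w : ℂ) (q : ℕ) {g : ℂ → ℂ}
    (hg : IsDiscPolyanalytic q g) :
    ∃ h : ℕ → ℂ → ℂ, (∀ k, DifferentiableOn ℂ (h k) disc) ∧
      ∀ z ∈ disc, g z = ∑ k ∈ Finset.range q, (starRingEnd ℂ) (z - w) ^ k * h k z := by
  induction q generalizing g with
  | zero => exact ⟨fun _ _ => 0, fun _ => differentiableOn_const 0, fun z hz => by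
      simpa using hg.2 z hz⟩
  | succ q ih =>
    obtain ⟨hg1, hg2⟩ := hg
    obtain ⟨h, hh, hsum⟩ := ih (g := discDbar g)
      ⟨contDiffOn_discDbar (m := q) (by exact_mod_cast hg1), hg2⟩
    -- `G` is a termwise `∂/∂z̄`-primitive of the expansion of `discDbar g`, so `g - G` is
    -- holomorphic. It becomes the coefficient of index `0`, and the old coefficients move up by
    -- one, divided by `k + 1`.
    set G : ℂ → ℂ := fun z => ∑ k ∈ Finset.range q,
      (1 / (k + 1 : ℂ)) * ((starRingEnd ℂ) (z - w) ^ (k + 1) * h k z) with hG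
    have hterm : ∀ k, ∀ z ∈ disc, DifferentiableAt ℝ
        (fun z => (starRingEnd ℂ) (z - w) ^ (k + 1) * h k z) z := fun k z hz =>
      (differentiable_conj_sub_pow w _ z).mul (differentiableAt_real_of_holomorphic (hh k) hz)
    have hGd : ∀ z ∈ disc, DifferentiableAt ℝ G z := fun z hz =>
      DifferentiableAt.fun_sum fun k _ => (hterm k z hz).const_mul _
    have hgd : ∀ z ∈ disc, DifferentiableAt ℝ g z := fun z hz =>
      (hg1.differentiableOn (by simp)).differentiableAt (isOpen_disc.mem_nhds hz)
    have hhol : DifferentiableOn ℂ (fun z => g z - G z) disc := by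
      intro z hz
      refine ((discDbar_eq_zero_iff ((hgd z hz).sub (hGd z hz))).1 ?_).differentiableWithinAt
      change discDbar (fun t => g t - G t) z = 0
      rw [discDbar_sub (hgd z hz) (hGd z hz), hsum z hz, hG,
        discDbar_sum _ (fun k _ => (hterm k z hz).const_mul _), sub_eq_zero]
      refine Finset.sum_congr rfl fun k _ => ?_
      rw [discDbar_const_mul _ (hterm k z hz), discDbar_conj_pow_succ_mul w k (hh k) hz]
      have : (k + 1 : ℂ) ≠ 0 := by exact_mod_cast k.succ_ne_zero
      field_simp
    refine ⟨fun k => Nat.casesOn k (fun z => g z - G z) fun k z => 1 / (k + 1 : ℂ) * h k z,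
      ?_, fun z hz => ?_⟩
    · rintro (_ | k)
      · exact hhol
      · exact (hh k).const_mul _
    · rw [Finset.sum_range_succ']
      simp only [hG, pow_zero, one_mul]
      rw [add_comm, ← sub_eq_iff_eq_add]
      congr 1
      exact Finset.sum_congr rfl fun k _ => by ring

theorem contDiffOn_real_of_holomorphic {h : ℂ → ℂ} (hh : DifferentiableOn ℂ h disc) :
    ContDiffOn ℝ ∞ h disc :=
  (hh.contDiffOn isOpen_disc).restrict_scalars ℝ

theorem contDiff_conj_sub_pow (w : ℂ) (k : ℕ) :
    ContDiff ℝ ∞ (fun t => (starRingEnd ℂ) (t - w) ^ k) :=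
  ((conjCLE.contDiff).comp (contDiff_id.sub contDiff_const)).pow k

/-- The decomposition upgrades class `C^q` to `C^∞`. Products of one-variable functions need this,
because the polydisc definition asks for class `C^(∑ q j)`. -/
theorem IsDiscPolyanalytic.contDiffOn {q : ℕ} {g : ℂ → ℂ} (hg : IsDiscPolyanalytic q g) :
    ContDiffOn ℝ ∞ g disc := by
  obtain ⟨h, hh, hsum⟩ := hg.exists_decomposition 0
  refine ContDiffOn.congr (ContDiffOn.sum fun k _ => ?_) hsum
  exact (contDiff_conj_sub_pow 0 k).contDiffOn.mul (contDiffOn_real_of_holomorphic (hh k))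

/-- Each `∂/∂z̄` lowers the power of `conj t` by one and leaves a holomorphic factor, so `k + 1 ≤ q`
applications suffice. -/
theorem discDbar_iterate_conj_pow_mul (q : ℕ) {k : ℕ} (hk : k < q) {h : ℂ → ℂ}
    (hh : DifferentiableOn ℂ h disc) :
    Set.EqOn (discDbar^[q] (fun t => (starRingEnd ℂ) t ^ k * h t)) 0 disc := by
  induction q generalizing k h with
  | zero => omega
  | succ q ih =>
    rw [Function.iterate_succ_apply]
    rcases k with _ | k
    · have : Set.EqOn (discDbar (fun t => (starRingEnd ℂ) t ^ 0 * h t)) 0 disc := by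
        intro z hz
        simp only [pow_zero, one_mul]
        exact (discDbar_eq_zero_iff (differentiableAt_real_of_holomorphic hh hz)).2
          (hh.differentiableAt (isOpen_disc.mem_nhds hz))
      have h0 := discDbar_iterate_congr q this
      rwa [Function.iterate_fixed discDbar_zero] at h0
    · have : Set.EqOn (discDbar (fun t => (starRingEnd ℂ) t ^ (k + 1) * h t))
          (fun t => (starRingEnd ℂ) t ^ k * ((k + 1 : ℂ) * h t)) disc := by
        intro z hz
        have := discDbar_conj_pow_succ_mul 0 k hh hz
        simp only [sub_zero] at this
        rw [this]; ring
      exact (discDbar_iterate_congr q this).trans (ih (by omega) (hh.const_mul _))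

theorem isDiscPolyanalytic_conj_pow_mul {q k : ℕ} (hk : k < q) {h : ℂ → ℂ}
    (hh : DifferentiableOn ℂ h disc) :
    IsDiscPolyanalytic q (fun t => (starRingEnd ℂ) t ^ k * h t) := by
  refine ⟨?_, fun z hz => discDbar_iterate_conj_pow_mul q hk hh hz⟩
  have := (contDiff_conj_sub_pow 0 k).contDiffOn.mul (contDiffOn_real_of_holomorphic hh)
  simp only [sub_zero] at this
  exact this.of_le (by exact_mod_cast le_top)

/-! ### Slices and products -/

variable {n : ℕ}

theorem update_mem_polydisc {z : Fin n → ℂ} (hz : z ∈ polydisc n) (j : Fin n) {t : ℂ}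
    (ht : t ∈ disc) : Function.update z j t ∈ polydisc n := by
  intro i
  rcases eq_or_ne i j with rfl | h
  · rw [Function.update_self]; exact ht
  · simpa [h] using hz i

theorem dbar_eq_discDbar_slice {f : (Fin n → ℂ) → ℂ} (z : Fin n → ℂ) (j : Fin n) (t : ℂ)
    (hf : DifferentiableAt ℝ f (Function.update z j t)) :
    discDbar (fun s => f (Function.update z j s)) t = dbar j f (Function.update z j t) := by
  have h := (hf.hasFDerivAt.comp t (hasFDerivAt_update (𝕜 := ℝ) z t)).fderiv
  have e : ∀ v : ℂ, (ContinuousLinearMap.pi (Pi.single j (ContinuousLinearMap.id ℝ ℂ)) :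
      ℂ →L[ℝ] (Fin n → ℂ)) v = Pi.single j v := by
    intro v; ext i
    rcases eq_or_ne i j with rfl | h
    · simp
    · simp [h]
  simp only [discDbar, dbar]
  change (1 / 2 : ℂ) * (fderiv ℝ (f ∘ Function.update z j) t 1 +
    I * fderiv ℝ (f ∘ Function.update z j) t I) = _
  rw [h]
  simp only [ContinuousLinearMap.comp_apply, e]

/-- Chain rule along `Function.update z j`. It transfers polyanalyticity both ways: to slices of a
function, and from one-variable factors to their product. -/
theorem discDbar_iterate_slice {z : Fin n → ℂ} (hz : z ∈ polydisc n) (j : Fin n) (k : ℕ)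
    {f : (Fin n → ℂ) → ℂ} (hf : ContDiffOn ℝ k f (polydisc n)) :
    Set.EqOn (discDbar^[k] (fun s => f (Function.update z j s)))
      (fun s => (dbar j)^[k] f (Function.update z j s)) disc := by
  induction k generalizing f with
  | zero => intro t _; rfl
  | succ k ih =>
    simp only [Function.iterate_succ_apply]
    refine (discDbar_iterate_congr k fun t ht => ?_).trans (ih (contDiffOn_dbar j hf))
    exact dbar_eq_discDbar_slice z j t ((hf.differentiableOn (by simp)).differentiableAt
      (isOpen_polydisc.mem_nhds (update_mem_polydisc hz j ht)))

theorem IsPolyanalytic.slice {q : Fin n → ℕ} {f : (Fin n → ℂ) → ℂ} (hf : IsPolyanalytic q f)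
    {z : Fin n → ℂ} (hz : z ∈ polydisc n) (j : Fin n) :
    IsDiscPolyanalytic (q j) (fun t => f (Function.update z j t)) := by
  have hle : ((q j : ℕ) : WithTop ℕ∞) ≤ ((∑ j, q j : ℕ) : WithTop ℕ∞) := by
    exact_mod_cast Finset.single_le_sum (fun i _ => Nat.zero_le (q i)) (Finset.mem_univ j)
  have hc := hf.1.of_le hle
  refine ⟨hc.comp (contDiff_update _ z j).contDiffOn fun t ht => update_mem_polydisc hz j ht, ?_⟩
  intro t ht
  rw [discDbar_iterate_slice hz j (q j) hc ht]
  exact hf.2 j _ (update_mem_polydisc hz j ht)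

theorem contDiffOn_prod_apply {g : Fin n → ℂ → ℂ} (hg : ∀ j, ContDiffOn ℝ ∞ (g j) disc) :
    ContDiffOn ℝ ∞ (fun z : Fin n → ℂ => ∏ j, g j (z j)) (polydisc n) :=
  contDiffOn_prod fun j _ => (hg j).comp (contDiff_apply ℝ ℂ j).contDiffOn fun _ hz => hz j

theorem prod_apply_update (g : Fin n → ℂ → ℂ) (z : Fin n → ℂ) (j : Fin n) (t : ℂ) :
    ∏ i, g i (Function.update z j t i) = (∏ i ∈ Finset.univ.erase j, g i (z i)) * g j t := by
  rw [← Finset.prod_erase_mul _ _ (Finset.mem_univ j), Function.update_self]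
  congr 1
  exact Finset.prod_congr rfl fun i hi => by
    rw [Function.update_of_ne (Finset.ne_of_mem_erase hi)]

theorem discDbar_iterate_const_mul (c : ℂ) (k : ℕ) {g : ℂ → ℂ} (hg : ContDiffOn ℝ ∞ g disc) :
    Set.EqOn (discDbar^[k] (fun t => c * g t)) (fun t => c * discDbar^[k] g t) disc := by
  induction k generalizing g with
  | zero => intro t _; rfl
  | succ k ih =>
    simp only [Function.iterate_succ_apply]
    refine (discDbar_iterate_congr k fun t ht => ?_).trans
      (ih (contDiffOn_discDbar (m := ⊤) (by simpa using hg)))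
    exact discDbar_const_mul c ((hg.differentiableOn (by simp)).differentiableAt
      (isOpen_disc.mem_nhds ht))

/-- Along the `j`-th coordinate the product is a constant times `g j`. -/
theorem isPolyanalytic_prod {q : Fin n → ℕ} {g : Fin n → ℂ → ℂ}
    (hg : ∀ j, IsDiscPolyanalytic (q j) (g j)) :
    IsPolyanalytic q (fun z => ∏ j, g j (z j)) := by
  have hc := contDiffOn_prod_apply fun j => (hg j).contDiffOn
  refine ⟨hc.of_le (by exact_mod_cast le_top), fun j z hz => ?_⟩
  have h := discDbar_iterate_slice hz j (q j) (hc.of_le (by exact_mod_cast le_top)) (hz j)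
  simp only [Function.update_eq_self] at h
  rw [← h]
  simp only [prod_apply_update]
  rw [discDbar_iterate_const_mul _ _ (hg j).contDiffOn (hz j)]
  simp only [(hg j).2 _ (hz j), mul_zero]

/-! ### The measures -/

/-- The density of `discMeasure α`. -/
def discWeight (α : ℝ) (z : ℂ) : ℝ := (1 / Real.pi) * (1 - ‖z‖ ^ 2) ^ α

theorem measurable_discWeight (α : ℝ) : Measurable (discWeight α) := by
  unfold discWeight
  fun_prop

theorem one_sub_norm_sq_pos {z : ℂ} (hz : z ∈ disc) : 0 < 1 - ‖z‖ ^ 2 := by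
  have h : ‖z‖ < 1 := hz
  nlinarith [norm_nonneg z]

theorem discWeight_pos (α : ℝ) {z : ℂ} (hz : z ∈ disc) : 0 < discWeight α z :=
  mul_pos (by positivity) (Real.rpow_pos_of_pos (one_sub_norm_sq_pos hz) _)

/-- In polar coordinates the integrand is `(1 - r) ^ α` times `r * (1 + r) ^ α / π`, which is
continuous on `[0, 1]`; the first factor is integrable because `-1 < α`. -/
theorem integrableOn_discWeight {α : ℝ} (hα : -1 < α) : IntegrableOn (discWeight α) disc := by
  rw [disc_eq_ball]
  unfold discWeight
  rw [integrableOn_fun_norm_addHaar volume (f := fun r : ℝ => (1 / Real.pi) * (1 - r ^ 2) ^ α)]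
  have h1 : IntegrableOn (fun r : ℝ => (1 - r) ^ α) (Set.Icc 0 1) := by
    have := (intervalIntegral.intervalIntegrable_rpow' (a := 0) (b := 1) hα).comp_sub_left 1
    simp only [sub_zero, sub_self] at this
    rw [intervalIntegrable_iff, Set.uIoc_comm, Set.uIoc_of_le zero_le_one] at this
    rwa [integrableOn_Icc_iff_integrableOn_Ioc]
  have h2 : ContinuousOn (fun r : ℝ => r * (1 / Real.pi) * (1 + r) ^ α) (Set.Icc 0 1) := by
    refine (by fun_prop : Continuous fun r : ℝ => r * (1 / Real.pi)).continuousOn.mul ?_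
    refine ContinuousOn.rpow_const (by fun_prop) fun r hr => Or.inl ?_
    linarith [hr.1]
  have h3 := (h1.continuousOn_mul h2 isCompact_Icc).mono_set Set.Ioo_subset_Icc_self
  refine h3.congr_fun (fun r hr => ?_) measurableSet_Ioo
  have e : 1 - r ^ 2 = (1 + r) * (1 - r) := by ring
  simp only [Complex.finrank_real_complex, Nat.add_one_sub_one, pow_one, smul_eq_mul, e]
  rw [Real.mul_rpow (by linarith [hr.1]) (by linarith [hr.2])]
  ring

theorem measurableSet_disc : MeasurableSet disc := isOpen_disc.measurableSet

theorem discMeasure_def (α : ℝ) : discMeasure α =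
    (volume.restrict disc).withDensity (fun z => ENNReal.ofReal (discWeight α z)) := rfl

theorem isFiniteMeasure_discMeasure {α : ℝ} (hα : -1 < α) : IsFiniteMeasure (discMeasure α) := by
  rw [discMeasure_def]
  exact isFiniteMeasure_withDensity_ofReal (integrableOn_discWeight hα).2

theorem ae_mem_disc (α : ℝ) : ∀ᵐ z ∂discMeasure α, z ∈ disc :=
  (withDensity_absolutelyContinuous _ _).ae_le (ae_restrict_mem measurableSet_disc)

theorem polydisc_eq_pi (n : ℕ) : polydisc n = Set.univ.pi fun _ => disc := by
  ext z; simp [polydisc, disc]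

theorem measurableSet_polydisc (n : ℕ) : MeasurableSet (polydisc n) := isOpen_polydisc.measurableSet

/-- The density of `polydiscMeasure n α`. -/
def polydiscWeight (n : ℕ) (α : ℝ) (z : Fin n → ℂ) : ℝ := ∏ j, discWeight α (z j)

theorem measurable_polydiscWeight (n : ℕ) (α : ℝ) : Measurable (polydiscWeight n α) :=
  Finset.measurable_prod _ fun j _ => (measurable_discWeight α).comp (measurable_pi_apply j)

theorem polydiscMeasure_def (n : ℕ) (α : ℝ) : polydiscMeasure n α =
    (volume.restrict (polydisc n)).withDensity
      (fun z => ENNReal.ofReal (polydiscWeight n α z)) := by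
  simp [polydiscMeasure, polydiscWeight, discWeight, Finset.prod_mul_distrib]

/-- The density factors, so the two measures agree on boxes by Fubini. The computation passes
through real integrals, hence the almost everywhere positivity of a weight that has no fixed sign
off the disc. -/
theorem polydiscMeasure_eq_pi {n : ℕ} {α : ℝ} (hα : -1 < α) :
    polydiscMeasure n α = Measure.pi fun _ => discMeasure α := by
  have := isFiniteMeasure_discMeasure hα
  refine (Measure.pi_eq fun s hs => ?_).symm
  have hint : ∀ j, Integrable (discWeight α) ((volume.restrict disc).restrict (s j)) := fun j =>
    Integrable.restrict (integrableOn_discWeight hα)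
  have hnn : ∀ j, 0 ≤ᵐ[(volume.restrict disc).restrict (s j)] discWeight α := fun j =>
    ae_restrict_of_ae ((ae_restrict_mem measurableSet_disc).mono
      fun z hz => (discWeight_pos α hz).le)
  rw [polydiscMeasure_def, withDensity_apply _ (MeasurableSet.univ_pi hs), polydisc_eq_pi,
    volume_pi, Measure.restrict_pi_pi, Measure.restrict_pi_pi, ← ofReal_integral_eq_lintegral_ofReal]
  · unfold polydiscWeight
    rw [integral_fintype_prod_eq_prod, ENNReal.ofReal_prod_of_nonneg
      fun j _ => integral_nonneg_of_ae (hnn j)]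
    refine Finset.prod_congr rfl fun j _ => ?_
    rw [ofReal_integral_eq_lintegral_ofReal (hint j) (hnn j), discMeasure_def,
      withDensity_apply _ (hs j)]
  · exact Integrable.fintype_prod hint
  · have : ∀ᵐ z ∂(Measure.pi fun j => (volume.restrict disc).restrict (s j)),
        ∀ j, 0 ≤ discWeight α (z j) := by
      rw [ae_all_iff]
      exact fun j => (Measure.tendsto_eval_ae_ae
        (μ := fun j => (volume.restrict disc).restrict (s j)) (i := j)).eventually (hnn j)
    filter_upwards [this] with z hz
    exact Finset.prod_nonneg fun j _ => hz j

theorem ae_mem_polydisc (n : ℕ) (α : ℝ) : ∀ᵐ z ∂polydiscMeasure n α, z ∈ polydisc n :=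
  (withDensity_absolutelyContinuous _ _).ae_le (ae_restrict_mem (measurableSet_polydisc n))

theorem isFiniteMeasure_polydiscMeasure {n : ℕ} {α : ℝ} (hα : -1 < α) :
    IsFiniteMeasure (polydiscMeasure n α) := by
  have := isFiniteMeasure_discMeasure hα
  rw [polydiscMeasure_eq_pi hα]
  infer_instance

/-! ### Rotation invariance of the measures -/

theorem measurePreserving_withDensity {X : Type*} [MeasurableSpace X] {μ : Measure X} {e : X → X}
    (he : MeasurePreserving e μ μ) {w : X → ℝ≥0∞} (hw : Measurable w) (hwe : ∀ x, w (e x) = w x) :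
    MeasurePreserving e (μ.withDensity w) (μ.withDensity w) := by
  refine ⟨he.measurable, ?_⟩
  ext s hs
  rw [Measure.map_apply he.measurable hs, withDensity_apply _ hs,
    withDensity_apply _ (he.measurable hs), ← he.setLIntegral_comp_preimage hs hw]
  simp only [hwe]

theorem measurePreserving_mul_volume {c : ℂ} (hc : ‖c‖ = 1) :
    MeasurePreserving (fun z : ℂ => c * z) :=
  (rotation ⟨c, mem_sphere_zero_iff_norm.2 hc⟩).measurePreserving

theorem measurePreserving_mul_restrict_ball {c : ℂ} (hc : ‖c‖ = 1) (r : ℝ) {μ : Measure ℂ}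
    (hμ : MeasurePreserving (fun z : ℂ => c * z) μ μ) :
    MeasurePreserving (fun z : ℂ => c * z) (μ.restrict (Metric.ball 0 r))
      (μ.restrict (Metric.ball 0 r)) := by
  have h := hμ.restrict_preimage (s := Metric.ball 0 r) measurableSet_ball
  have e : (fun z : ℂ => c * z) ⁻¹' Metric.ball 0 r = Metric.ball 0 r := by
    ext z; simp [hc]
  rwa [e] at h

theorem measurePreserving_mul_discMeasure (α : ℝ) {c : ℂ} (hc : ‖c‖ = 1) :
    MeasurePreserving (fun z : ℂ => c * z) (discMeasure α) (discMeasure α) := by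
  rw [discMeasure_def, disc_eq_ball]
  refine measurePreserving_withDensity
    (measurePreserving_mul_restrict_ball hc 1 (measurePreserving_mul_volume hc))
    (measurable_discWeight α).ennreal_ofReal fun z => ?_
  simp [discWeight, hc]

/-! ### Iterated reproducing formulas -/

/-- Cauchy–Schwarz with values in `ℝ≥0∞`, usable before any integrability is known. -/
theorem enorm_integral_mul_sq_le {X : Type*} [MeasurableSpace X] {μ : Measure X} {f g : X → ℂ}
    (hf : AEStronglyMeasurable f μ) (hg : AEStronglyMeasurable g μ) :
    ‖∫ x, f x * g x ∂μ‖ₑ ^ 2 ≤ (∫⁻ x, ‖f x‖ₑ ^ 2 ∂μ) * ∫⁻ x, ‖g x‖ₑ ^ 2 ∂μ := by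
  have h1 : ‖∫ x, f x * g x ∂μ‖ₑ ≤ ∫⁻ x, ‖f x‖ₑ * ‖g x‖ₑ ∂μ := by
    refine (enorm_integral_le_lintegral_enorm _).trans (lintegral_mono fun x => ?_)
    rw [enorm_mul]
  have h2 := ENNReal.lintegral_mul_le_Lp_mul_Lq μ Real.HolderConjugate.two_two hf.enorm hg.enorm
  have h3 := pow_le_pow_left' (h1.trans h2) 2
  refine h3.trans_eq ?_
  rw [mul_pow]
  simp only [← ENNReal.rpow_natCast, ← ENNReal.rpow_mul]
  norm_num

theorem memLp_two_iff_lintegral {X : Type*} [MeasurableSpace X] {μ : Measure X} {f : X → ℂ} :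
    MemLp f 2 μ ↔ AEStronglyMeasurable f μ ∧ ∫⁻ x, ‖f x‖ₑ ^ 2 ∂μ < ⊤ := by
  rw [MemLp, and_congr_right_iff]
  intro _
  rw [eLpNorm_lt_top_iff_lintegral_rpow_enorm_lt_top (by simp) (by simp)]
  simp

theorem memLp_prod_apply {X : Type*} [MeasurableSpace X] {n : ℕ} {μ : Fin n → Measure X}
    [∀ j, SigmaFinite (μ j)] {κ : Fin n → X → ℂ} (hκ : ∀ j, MemLp (κ j) 2 (μ j)) :
    MemLp (fun z : Fin n → X => ∏ j, κ j (z j)) 2 (Measure.pi μ) := by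
  rw [memLp_two_iff_integrable_sq_norm]
  · simp_rw [norm_prod, ← Finset.prod_pow]
    exact Integrable.fintype_prod fun j => (memLp_two_iff_integrable_sq_norm (hκ _).1).1 (hκ _)
  · exact Finset.aestronglyMeasurable_fun_prod _ fun j _ =>
      (hκ j).1.comp_quasiMeasurePreserving (Measure.quasiMeasurePreserving_eval _ j)

/-- If `f` is square integrable on a product and is reproduced in each variable separately by the
kernels `κ j`, then it is reproduced by the product of these kernels. -/
theorem eq_integral_prod_of_separately {X : Type*} [MeasurableSpace X] {n : ℕ}
    (μ : Fin n → Measure X) [∀ j, SigmaFinite (μ j)] (S : Fin n → Set X) (κ : Fin n → X → ℂ)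
    (w : Fin n → X) (f : (Fin n → X) → ℂ) (hS : ∀ j, ∀ᵐ x ∂μ j, x ∈ S j) (hw : ∀ j, w j ∈ S j)
    (hκ : ∀ j, MemLp (κ j) 2 (μ j)) (hf : MemLp f 2 (Measure.pi μ))
    (hrep : ∀ j z, (∀ i, z i ∈ S i) → MemLp (fun t => f (Function.update z j t)) 2 (μ j) →
      f (Function.update z j (w j)) = ∫ t, f (Function.update z j t) * κ j t ∂μ j) :
    f w = ∫ z, f z * ∏ j, κ j (z j) ∂Measure.pi μ := by
  induction n with
  | zero =>
    rw [Measure.pi_of_empty μ w, integral_unique]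
    simp [Subsingleton.elim w default]
  | succ n ih =>
    set μ' : Fin n → Measure X := fun j => μ j.succ
    have hcons : ⇑(MeasurableEquiv.piFinSuccAbove (fun _ : Fin (n + 1) => X) 0).symm =
        fun p : X × (Fin n → X) => (Fin.cons p.1 p.2 : Fin (n + 1) → X) := by
      funext p
      simp [MeasurableEquiv.piFinSuccAbove_symm_apply, Fin.insertNthEquiv]
    have hmp : MeasurePreserving (fun p : X × (Fin n → X) => (Fin.cons p.1 p.2 : Fin (n + 1) → X))
        ((μ 0).prod (Measure.pi μ')) (Measure.pi μ) := by
      rw [← hcons]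
      exact (measurePreserving_piFinSuccAbove μ 0).symm
    have hemb : MeasurableEmbedding
        (fun p : X × (Fin n → X) => (Fin.cons p.1 p.2 : Fin (n + 1) → X)) := by
      rw [← hcons]
      exact (MeasurableEquiv.piFinSuccAbove (fun _ : Fin (n + 1) => X) 0).symm.measurableEmbedding
    set F : X × (Fin n → X) → ℂ := fun p => f (Fin.cons p.1 p.2) with hF
    have hFL : MemLp F 2 ((μ 0).prod (Measure.pi μ')) := hf.comp_measurePreserving hmp
    have hS' : ∀ᵐ z ∂Measure.pi μ', ∀ i, z i ∈ S i.succ := by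
      rw [ae_all_iff]
      exact fun j => (Measure.tendsto_eval_ae_ae (μ := μ') (i := j)).eventually (hS j.succ)
    obtain ⟨hFm, hFfin⟩ := memLp_two_iff_lintegral.1 hFL
    rw [lintegral_prod_symm _ (hFm.enorm.pow_const 2)] at hFfin
    -- By Tonelli almost every slice in coordinate `0` is square integrable; `hrep` applies only to
    -- those.
    have hslice : ∀ᵐ z ∂Measure.pi μ', MemLp (fun t => F (t, z)) 2 (μ 0) := by
      filter_upwards [hFm.prod_swap.prodMk_left, ae_lt_top'
        ((hFm.prod_swap.enorm.pow_const 2).lintegral_prod_right') hFfin.ne] with z h1 h2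
      exact memLp_two_iff_lintegral.2 ⟨h1, h2⟩
    have hfirst : ∀ᵐ z ∂Measure.pi μ', F (w 0, z) = ∫ t, F (t, z) * κ 0 t ∂μ 0 := by
      filter_upwards [hS', hslice] with z hz hz2
      have := hrep 0 (Fin.cons (w 0) z) (Fin.cases (hw 0) hz) (by simpa using hz2)
      simpa using this
    have hmeas : AEStronglyMeasurable (fun p : X × (Fin n → X) => F p * κ 0 p.1)
        ((μ 0).prod (Measure.pi μ')) :=
      hFm.mul (hκ 0).1.comp_fst
    -- The set where the first coordinate equals `w 0` may be null, so nothing about `F (w 0, ·)`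
    -- follows from `F` being in `L²`. Its measurability and square integrability come from
    -- `hfirst`, which writes it almost everywhere as an integral, and from Cauchy–Schwarz.
    have hG : MemLp (fun z => F (w 0, z)) 2 (Measure.pi μ') := by
      rw [memLp_congr_ae hfirst, memLp_two_iff_lintegral]
      refine ⟨hmeas.prod_swap.integral_prod_right', ?_⟩
      calc _ ≤ ∫⁻ z, (∫⁻ t, ‖F (t, z)‖ₑ ^ 2 ∂μ 0) * ∫⁻ t, ‖κ 0 t‖ₑ ^ 2 ∂μ 0 ∂Measure.pi μ' := by
            refine lintegral_mono_ae ?_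
            filter_upwards [hslice] with z hz
            exact enorm_integral_mul_sq_le hz.1 (hκ 0).1
        _ = (∫⁻ z, (∫⁻ t, ‖F (t, z)‖ₑ ^ 2 ∂μ 0) ∂Measure.pi μ') * ∫⁻ t, ‖κ 0 t‖ₑ ^ 2 ∂μ 0 :=
            lintegral_mul_const'' _ ((hFm.prod_swap.enorm.pow_const 2).lintegral_prod_right')
        _ < ⊤ := ENNReal.mul_lt_top hFfin (memLp_two_iff_lintegral.1 (hκ 0)).2
    have hind := ih μ' (fun j => S j.succ) (fun j => κ j.succ) (fun j => w j.succ)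
      (fun z => F (w 0, z)) (fun j => hS _) (fun j => hw _) (fun j => hκ _) hG fun j z hz hL => by
        have := hrep j.succ (Fin.cons (w 0) z) (Fin.cases (hw 0) hz) (by
          simpa [hF, Fin.cons_update] using hL)
        simpa [hF, Fin.cons_update] using this
    have hprod : MemLp (fun z : Fin n → X => ∏ j, κ j.succ (z j)) 2 (Measure.pi μ') :=
      memLp_prod_apply fun j => hκ _
    have hprod2 : MemLp (fun p : X × (Fin n → X) => κ 0 p.1 * ∏ j, κ j.succ (p.2 j)) 2
        ((μ 0).prod (Measure.pi μ')) := by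
      refine (memLp_two_iff_integrable_sq_norm ((hκ 0).1.comp_fst.mul hprod.1.comp_snd)).2 ?_
      simp_rw [Pi.mul_apply, norm_mul, mul_pow]
      exact ((memLp_two_iff_integrable_sq_norm (hκ 0).1).1 (hκ 0)).mul_prod
        ((memLp_two_iff_integrable_sq_norm hprod.1).1 hprod)
    calc f w = F (w 0, fun j => w j.succ) := by
          simp only [hF]; congr 1; exact (Fin.cons_self_tail w).symm
      _ = ∫ z, F (w 0, z) * ∏ j, κ j.succ (z j) ∂Measure.pi μ' := hind
      _ = ∫ z, ∫ t, F (t, z) * (κ 0 t * ∏ j, κ j.succ (z j)) ∂μ 0 ∂Measure.pi μ' := by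
          refine integral_congr_ae ?_
          filter_upwards [hfirst] with z hz
          rw [hz, ← integral_mul_const]
          simp only [mul_assoc]
      _ = ∫ p, F p * (κ 0 p.1 * ∏ j, κ j.succ (p.2 j)) ∂(μ 0).prod (Measure.pi μ') :=
          (integral_prod_symm _ (hFL.integrable_mul hprod2)).symm
      _ = _ := by
          rw [← hmp.integral_comp hemb]
          simp [Fin.prod_univ_succ, hF]

/-! ### Power series and rotation invariant measures -/

theorem exists_power_series {R : ℝ} {h : ℂ → ℂ} (hh : DifferentiableOn ℂ h (Metric.ball 0 R)) :
    ∃ a : ℕ → ℂ, (∀ z ∈ Metric.ball (0 : ℂ) R, HasSum (fun m => a m * z ^ m) (h z)) ∧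
      ∀ ρ, 0 ≤ ρ → ρ < R → Summable fun m => ‖a m‖ * ρ ^ m := by
  have key : ∀ z ∈ Metric.ball (0 : ℂ) R,
      HasSum (fun m : ℕ => ((m.factorial : ℂ)⁻¹ * iteratedDeriv m h 0) * z ^ m) (h z) := by
    intro z hz
    convert! Complex.hasSum_taylorSeries_on_ball hh hz using 2 with m
    simp only [sub_zero, smul_eq_mul]
    ring
  refine ⟨_, key, fun ρ h0 h1 => ?_⟩
  have := (key (ρ : ℂ) (by simpa [abs_of_nonneg h0] using h1)).summable.norm
  simpa [abs_of_nonneg h0] using this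

/-- Rotation by the angle `π / (i - j)` preserves the measure and multiplies the integrand by `c ^ i
* conj c ^ j = -1`, so the integral is its own negative. -/
theorem integral_monomial_radial {μ : Measure ℂ}
    (hμ : ∀ c : ℂ, ‖c‖ = 1 → MeasurePreserving (fun z : ℂ => c * z) μ μ) {ψ : ℂ → ℂ}
    (hψ : ∀ c z : ℂ, ‖c‖ = 1 → ψ (c * z) = ψ z) {i j : ℕ} (hij : i ≠ j) :
    ∫ z, z ^ i * (starRingEnd ℂ) z ^ j * ψ z ∂μ = 0 := by
  have hij' : (i : ℂ) - j ≠ 0 := sub_ne_zero.2 (by exact_mod_cast hij)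
  set θ : ℝ := Real.pi / ((i : ℝ) - j) with hθ
  set c : ℂ := exp (θ * I) with hc
  have hc1 : ‖c‖ = 1 := norm_exp_ofReal_mul_I θ
  have hconj : (starRingEnd ℂ) c = exp (-(θ * I)) := by
    rw [hc, ← exp_conj]; simp
  have hcij : c ^ i * (starRingEnd ℂ) c ^ j = -1 := by
    rw [hconj, hc, ← exp_nat_mul, ← exp_nat_mul, ← exp_add, ← exp_pi_mul_I]
    congr 1
    rw [hθ]
    push_cast
    field_simp
    ring
  have hc0 : c ≠ 0 := exp_ne_zero _
  have h := (hμ c hc1).integral_comp (measurableEmbedding_mulLeft₀ hc0)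
    (fun z => z ^ i * (starRingEnd ℂ) z ^ j * ψ z)
  have e : ∀ z : ℂ, (c * z) ^ i * (starRingEnd ℂ) (c * z) ^ j * ψ (c * z) =
      -1 * (z ^ i * (starRingEnd ℂ) z ^ j * ψ z) := by
    intro z
    rw [hψ c z hc1, ← hcij, map_mul, mul_pow, mul_pow]
    ring
  simp only [e, integral_const_mul] at h
  linear_combination (-1 / 2 : ℂ) * h

/-- Integrate the power series of `h` termwise, dominated by the summable `‖a m‖ * ρ ^ m`; only the
index with `m + i = j` survives rotation. -/
theorem integral_holomorphic_mul_monomial {μ : Measure ℂ}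
    (hμ : ∀ c : ℂ, ‖c‖ = 1 → MeasurePreserving (fun z : ℂ => c * z) μ μ) {ψ : ℂ → ℂ}
    (hψ : ∀ c z : ℂ, ‖c‖ = 1 → ψ (c * z) = ψ z) (hψi : Integrable ψ μ) {R ρ : ℝ} (hρ : 0 ≤ ρ)
    (hρR : ρ < R) (hball : ∀ᵐ z ∂μ, ‖z‖ ≤ ρ) {h : ℂ → ℂ} {a : ℕ → ℂ}
    (ha : ∀ z ∈ Metric.ball (0 : ℂ) R, HasSum (fun m => a m * z ^ m) (h z))
    (has : Summable fun m => ‖a m‖ * ρ ^ m) (i j : ℕ) :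
    ∫ z, h z * (z ^ i * (starRingEnd ℂ) z ^ j * ψ z) ∂μ =
      (if i ≤ j then a (j - i) else 0) * ∫ z, z ^ j * (starRingEnd ℂ) z ^ j * ψ z ∂μ := by
  have hs : HasSum (fun m => ∫ z, a m * (z ^ (m + i) * (starRingEnd ℂ) z ^ j * ψ z) ∂μ)
      (∫ z, h z * (z ^ i * (starRingEnd ℂ) z ^ j * ψ z) ∂μ) := by
    refine hasSum_integral_of_dominated_convergence
      (fun m z => (‖a m‖ * ρ ^ m) * (ρ ^ i * ρ ^ j * ‖ψ z‖)) (fun m => ?_) (fun m => ?_) ?_ ?_ ?_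
    · refine AEStronglyMeasurable.const_mul (AEStronglyMeasurable.mul ?_ hψi.1) _
      exact (by fun_prop :
        Continuous fun z : ℂ => z ^ (m + i) * (starRingEnd ℂ) z ^ j).aestronglyMeasurable
    · filter_upwards [hball] with z hz
      simp only [norm_mul, norm_pow, RCLike.norm_conj]
      have e : ‖a m‖ * ρ ^ m * (ρ ^ i * ρ ^ j * ‖ψ z‖) =
        ‖a m‖ * (ρ ^ (m + i) * ρ ^ j * ‖ψ z‖) := by ring
      rw [e]
      gcongr
    · exact Filter.Eventually.of_forall fun z => has.mul_right _
    · simp_rw [tsum_mul_right]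
      exact (hψi.norm.const_mul _).const_mul _
    · filter_upwards [hball] with z hz
      have := (ha z (by simpa using hz.trans_lt hρR)).mul_right
        (z ^ i * (starRingEnd ℂ) z ^ j * ψ z)
      convert! this using 2 with m
      ring
  simp_rw [integral_const_mul] at hs
  refine hs.unique ?_
  split_ifs with hij
  · convert! hasSum_single (f := fun m => a m * ∫ z, z ^ (m + i) * (starRingEnd ℂ) z ^ j * ψ z ∂μ)
      (j - i) (fun m hm => ?_) using 2
    · rw [Nat.sub_add_cancel hij]
    · rw [integral_monomial_radial hμ hψ (by omega), mul_zero]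
  · rw [zero_mul]
    convert! hasSum_zero using 2 with m
    rw [integral_monomial_radial hμ hψ (by omega), mul_zero]

/-! ### Local reproducing formula for polyanalytic functions -/

/-- Distinct nodes make the Vandermonde matrix invertible, so its rows combine to the first basis
vector. -/
theorem exists_sum_mul_pow_eq (q : ℕ) {x : Fin q → ℝ} (hx : Function.Injective x) :
    ∃ c : Fin q → ℝ, ∀ k < q, ∑ i, c i * x i ^ k = if k = 0 then 1 else 0 := by
  have hdet : IsUnit (Matrix.vandermonde x).det :=
    (Matrix.det_vandermonde_ne_zero_iff.2 hx).isUnit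
  refine ⟨Matrix.vecMul (fun k : Fin q => if (k : ℕ) = 0 then 1 else 0)
    (Matrix.vandermonde x)⁻¹, fun k hk => ?_⟩
  set b : Fin q → ℝ := fun k : Fin q => if (k : ℕ) = 0 then 1 else 0 with hb
  have h : Matrix.vecMul (Matrix.vecMul b (Matrix.vandermonde x)⁻¹) (Matrix.vandermonde x) = b := by
    rw [Matrix.vecMul_vecMul, Matrix.nonsing_inv_mul _ hdet, Matrix.vecMul_one]
  have := congrFun h ⟨k, hk⟩
  simpa [Matrix.vecMul, dotProduct, Matrix.vandermonde_apply, hb] using this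

/-- A smooth radial cutoff supported in the ball of radius `ε`. -/
def radialCutoff (ε : ℝ) (z : ℂ) : ℝ := Real.smoothTransition (1 - ‖z‖ ^ 2 / ε ^ 2)

theorem contDiff_radialCutoff (ε : ℝ) : ContDiff ℝ ∞ (radialCutoff ε) :=
  Real.smoothTransition.contDiff.comp (contDiff_const.sub ((contDiff_norm_sq ℝ).div_const _))

theorem radialCutoff_eq_zero {ε : ℝ} (hε : 0 < ε) {z : ℂ} (hz : ε ≤ ‖z‖) :
    radialCutoff ε z = 0 := by
  refine Real.smoothTransition.zero_of_nonpos ?_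
  rw [sub_nonpos, one_le_div (by positivity)]
  gcongr

theorem hasCompactSupport_of_eq_zero {F : ℂ → ℂ} {ε : ℝ} (hF : ∀ z, ε ≤ ‖z‖ → F z = 0) :
    HasCompactSupport F := by
  refine HasCompactSupport.intro (isCompact_closedBall (0 : ℂ) ε) fun z hz => hF z ?_
  simp only [mem_closedBall_zero_iff, not_le] at hz
  exact hz.le

theorem integral_radialCutoff_pos {ε : ℝ} (hε : 0 < ε) : 0 < ∫ z, radialCutoff ε z := by
  refine (contDiff_radialCutoff ε).continuous.integral_pos_of_hasCompactSupport_nonneg_nonzero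
    (x := 0) ?_ (fun z => Real.smoothTransition.nonneg _) ?_
  · refine HasCompactSupport.intro (isCompact_closedBall (0 : ℂ) ε) fun z hz => ?_
    simp only [mem_closedBall_zero_iff, not_le] at hz
    exact radialCutoff_eq_zero hε hz.le
  · simp [radialCutoff]

/-- A smooth radial function with small support whose moments agree with those of a point mass. -/
structure IsReproducingBump (q : ℕ) (ε : ℝ) (φ : ℂ → ℂ) : Prop where
  contDiff : ContDiff ℝ ∞ φ
  eq_zero : ∀ z, ε ≤ ‖z‖ → φ z = 0
  radial : ∀ c z : ℂ, ‖c‖ = 1 → φ (c * z) = φ z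
  moments : ∀ k < q, ∫ z, z ^ k * (starRingEnd ℂ) z ^ k * φ z = if k = 0 then 1 else 0

/-- Combine the dilates `χ ((i + 1) z)`, `i < q`, of a radial cutoff. Dilation by `r` multiplies the
moment of order `k` by `(r⁻²) ^ k * r⁻²`, so prescribing the moments is the Vandermonde problem with
nodes `(i + 1)⁻²`. Since `i + 1 ≥ 1`, the supports do not grow. -/
theorem exists_isReproducingBump (q : ℕ) {ε : ℝ} (hε : 0 < ε) :
    ∃ φ, IsReproducingBump q ε φ := by
  obtain ⟨c, hc⟩ := exists_sum_mul_pow_eq q (x := fun i : Fin q => ((i : ℝ) + 1)⁻¹ ^ 2)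
    (fun i j hij => by
      have hp : ∀ i : Fin q, (0 : ℝ) ≤ ((i : ℝ) + 1)⁻¹ := fun i => by positivity
      have := (pow_left_inj₀ (hp i) (hp j) two_ne_zero).1 hij
      have := add_right_cancel (inv_injective this)
      exact Fin.ext (by exact_mod_cast this))
  set χ : ℂ → ℂ := fun z => radialCutoff ε z with hχ
  set M : ℂ := ∫ z, χ z with hM
  have hM0 : M ≠ 0 := by
    have e : M = ((∫ z, radialCutoff ε z : ℝ) : ℂ) := integral_ofReal
    rw [e]
    exact_mod_cast (integral_radialCutoff_pos hε).ne'
  have hχs : ContDiff ℝ ∞ χ := ofRealCLM.contDiff.comp (contDiff_radialCutoff ε)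
  have hχc : HasCompactSupport χ := hasCompactSupport_of_eq_zero (ε := ε) fun z hz => by
    simp [hχ, radialCutoff_eq_zero hε hz]
  -- The factor `(i + 1) ^ 2` cancels the Jacobian of the dilation, and `M` normalises the total
  -- mass.
  set φ : ℂ → ℂ := fun z =>
    ∑ i : Fin q, ((c i : ℂ) * ((i : ℝ) + 1 : ℝ) ^ 2 / M) * χ (((i : ℝ) + 1 : ℝ) • z) with hφ
  have hmom : ∀ (k : ℕ) (r : ℝ), 0 < r → ∫ z : ℂ, z ^ k * (starRingEnd ℂ) z ^ k * χ (r • z) =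
      ((r⁻¹ ^ 2 : ℝ) : ℂ) ^ k * ((r : ℂ) ^ 2)⁻¹ * ∫ z, z ^ k * (starRingEnd ℂ) z ^ k * χ z := by
    intro k r hr
    have h := Measure.integral_comp_smul (volume : Measure ℂ)
      (fun z => z ^ k * (starRingEnd ℂ) z ^ k * χ z) r
    have hr' : (r : ℂ) ≠ 0 := by exact_mod_cast hr.ne'
    have e : ∀ z : ℂ, (r • z) ^ k * (starRingEnd ℂ) (r • z) ^ k * χ (r • z) =
        ((r : ℂ) ^ 2) ^ k * (z ^ k * (starRingEnd ℂ) z ^ k * χ (r • z)) := by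
      intro z
      simp only [real_smul, map_mul, conj_ofReal]
      ring
    simp only [e] at h
    simp only [integral_const_mul, finrank_real_complex, abs_inv, abs_pow, abs_of_pos hr] at h
    rw [real_smul] at h
    push_cast at h ⊢
    have h2 : ((r : ℂ) ^ 2) ^ k ≠ 0 := by positivity
    rw [inv_pow, inv_pow, mul_assoc, ← h, inv_mul_cancel_left₀ h2]
  refine ⟨φ, ?_, fun z hz => ?_, fun u z hu => ?_, fun k hk => ?_⟩
  · exact ContDiff.sum fun i _ => contDiff_const.mul (hχs.comp (contDiff_const_smul _))
  · refine Finset.sum_eq_zero fun i _ => ?_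
    have : ε ≤ ‖((i : ℝ) + 1 : ℝ) • z‖ := by
      rw [norm_smul, Real.norm_of_nonneg (by positivity)]
      have : (0 : ℝ) ≤ i := by positivity
      nlinarith [norm_nonneg z]
    simp only [hχ, radialCutoff_eq_zero hε this, ofReal_zero, mul_zero]
  · refine Finset.sum_congr rfl fun i _ => ?_
    simp only [hχ, radialCutoff, norm_smul, norm_mul, hu, one_mul]
  · have hint : ∀ i : Fin q, Integrable fun z : ℂ => z ^ k * (starRingEnd ℂ) z ^ k *
        χ (((i : ℝ) + 1 : ℝ) • z) := by
      intro i
      refine Continuous.integrable_of_hasCompactSupport ?_ ?_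
      · have := hχs.continuous
        fun_prop
      · exact (hχc.comp_smul (by positivity)).mul_left
    have e : ∀ z : ℂ, z ^ k * (starRingEnd ℂ) z ^ k * φ z = ∑ i : Fin q,
        ((c i : ℂ) * ((i : ℝ) + 1 : ℝ) ^ 2 / M) *
          (z ^ k * (starRingEnd ℂ) z ^ k * χ (((i : ℝ) + 1 : ℝ) • z)) := by
      intro z
      rw [hφ, Finset.mul_sum]
      exact Finset.sum_congr rfl fun i _ => by ring
    simp_rw [e]
    rw [integral_finsetSum _ fun i _ => (hint i).const_mul _]
    simp_rw [integral_const_mul]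
    have e2 : ∀ i : Fin q, ((c i : ℂ) * ((i : ℝ) + 1 : ℝ) ^ 2 / M) *
        ∫ z : ℂ, z ^ k * (starRingEnd ℂ) z ^ k * χ (((i : ℝ) + 1 : ℝ) • z) =
        ((c i * (((i : ℝ) + 1)⁻¹ ^ 2) ^ k : ℝ) : ℂ) *
          (M⁻¹ * ∫ z, z ^ k * (starRingEnd ℂ) z ^ k * χ z) := by
      intro i
      have hpos : (0 : ℝ) < (i : ℝ) + 1 := by positivity
      have hne : (((i : ℝ) + 1 : ℝ) : ℂ) ≠ 0 := by exact_mod_cast hpos.ne'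
      rw [hmom k _ hpos]
      push_cast at hne ⊢
      field_simp
    simp_rw [e2]
    rw [← Finset.sum_mul, ← ofReal_sum, hc k hk]
    split_ifs with h0
    · subst h0
      simp [← hM, hM0]
    · simp

/-- Expand `g` in powers of `conj (t - w)` and each coefficient in a power series at `w`. The term
of index `k` contributes `a k k` times the `k`-th moment of `φ`, so only `a 0 0 = h 0 w = g w` is
left. -/
theorem IsDiscPolyanalytic.integral_mul_bump {q : ℕ} {ε : ℝ} {φ : ℂ → ℂ} (hε : 0 < ε)
    (hφ : IsReproducingBump q ε φ) {g : ℂ → ℂ} (hg : IsDiscPolyanalytic q g) {w : ℂ}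
    (hw : ‖w‖ + ε < 1) : ∫ t, g t * φ (w - t) = g w := by
  obtain ⟨h, hh, hsum⟩ := hg.exists_decomposition w
  obtain ⟨R, hR1, hR2⟩ := exists_between (show ε < 1 - ‖w‖ by linarith)
  have hmem : ∀ s ∈ Metric.ball (0 : ℂ) R, w + s ∈ disc := fun s hs =>
    (norm_add_le w s).trans_lt (by have := mem_ball_zero_iff.1 hs; linarith)
  have hhd : ∀ k, DifferentiableOn ℂ (fun s => h k (w + s)) (Metric.ball 0 R) := fun k =>
    (hh k).comp (differentiableOn_const w |>.add differentiableOn_id) hmem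
  choose a ha has using fun k => exists_power_series (hhd k)
  set μ : Measure ℂ := volume.restrict (Metric.ball 0 ε)
  have hμ : ∀ c : ℂ, ‖c‖ = 1 → MeasurePreserving (fun z : ℂ => c * z) μ μ := fun c hc =>
    measurePreserving_mul_restrict_ball hc ε (measurePreserving_mul_volume hc)
  have hball : ∀ᵐ z ∂μ, ‖z‖ ≤ ε := (ae_restrict_mem measurableSet_ball).mono
    fun z hz => (mem_ball_zero_iff.1 hz).le
  have hφi : Integrable φ μ := (hφ.contDiff.continuous.integrable_of_hasCompactSupport
    (hasCompactSupport_of_eq_zero hφ.eq_zero)).restrict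
  have hzero : ∀ F : ℂ → ℂ, ∫ z, F z * φ z ∂μ = ∫ z, F z * φ z := fun F =>
    setIntegral_eq_integral_of_forall_compl_eq_zero fun z hz => by
      rw [hφ.eq_zero z (by simpa using hz), mul_zero]
  have hint : ∀ k, Integrable (fun s => h k (w + s) * (s ^ 0 * (starRingEnd ℂ) s ^ k * φ s)) μ := by
    intro k
    have : ContinuousOn (fun s => h k (w + s) * (s ^ 0 * (starRingEnd ℂ) s ^ k * φ s))
        (Metric.closedBall 0 ε) := by
      refine ((hhd k).continuousOn.mono (Metric.closedBall_subset_ball hR1)).mul ?_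
      have := hφ.contDiff.continuous
      fun_prop
    exact (this.integrableOn_compact (isCompact_closedBall _ _)).mono_set
      Metric.ball_subset_closedBall
  calc ∫ t, g t * φ (w - t) = ∫ s, g (w + s) * φ s := by
        rw [← integral_add_left_eq_self _ w]
        refine integral_congr_ae (Filter.Eventually.of_forall fun s => ?_)
        have := hφ.radial (-1) s (by simp)
        simp only [neg_mul, one_mul] at this
        simp [this]
    _ = ∫ s, g (w + s) * φ s ∂μ := (hzero fun s => g (w + s)).symm
    _ = ∫ s, ∑ k ∈ Finset.range q, h k (w + s) * (s ^ 0 * (starRingEnd ℂ) s ^ k * φ s) ∂μ := by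
        refine integral_congr_ae ((ae_restrict_mem measurableSet_ball).mono fun s hs => ?_)
        simp only [hsum _ (hmem s (Metric.ball_subset_ball hR1.le hs)), Finset.sum_mul]
        refine Finset.sum_congr rfl fun k _ => ?_
        rw [add_sub_cancel_left]
        ring
    _ = ∑ k ∈ Finset.range q, a k k * if k = 0 then 1 else 0 := by
        rw [integral_finsetSum _ fun k _ => hint k]
        refine Finset.sum_congr rfl fun k hk => ?_
        rw [integral_holomorphic_mul_monomial hμ hφ.radial hφi hε.le hR1 hball (ha k)
          (has k ε hε.le hR1) 0 k, if_pos (Nat.zero_le k), Nat.sub_zero,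
          ← hφ.moments k (Finset.mem_range.1 hk), hzero fun z => z ^ k * (starRingEnd ℂ) z ^ k]
    _ = g w := by
        have hw1 : w ∈ disc := by
          have : ‖w‖ < 1 := by linarith
          exact this
        rw [hsum w hw1]
        refine Finset.sum_congr rfl fun k hk => ?_
        rcases Nat.eq_zero_or_pos k with rfl | hk0
        · have h0 : HasSum (fun m => a 0 m * (0 : ℂ) ^ m) (h 0 (w + 0)) :=
            ha 0 0 (by simp; linarith)
          have h1 := hasSum_single (f := fun m => a 0 m * (0 : ℂ) ^ m) 0
            fun m hm => by simp [hm]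
          simpa using h1.unique h0
        · simp [hk0.ne']

/-! ### Density of the monomials in one variable -/

/-- The monomial `z ^ m * conj z ^ k`. -/
def discMonomial (k m : ℕ) (z : ℂ) : ℂ := z ^ m * (starRingEnd ℂ) z ^ k

theorem continuous_discMonomial (k m : ℕ) : Continuous (discMonomial k m) := by
  unfold discMonomial
  fun_prop

theorem norm_discMonomial_le (k m : ℕ) {z : ℂ} (hz : z ∈ disc) : ‖discMonomial k m z‖ ≤ 1 := by
  have h : ‖z‖ ≤ 1 := le_of_lt hz
  rw [discMonomial, norm_mul, norm_pow, norm_pow, RCLike.norm_conj]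
  exact mul_le_one₀ (pow_le_one₀ (norm_nonneg _) h) (by positivity) (pow_le_one₀ (norm_nonneg _) h)

theorem memLp_discMonomial {α : ℝ} (hα : -1 < α) (k m : ℕ) :
    MemLp (discMonomial k m) 2 (discMeasure α) := by
  have := isFiniteMeasure_discMeasure hα
  exact MemLp.of_bound (continuous_discMonomial k m).aestronglyMeasurable 1
    ((ae_mem_disc α).mono fun z hz => norm_discMonomial_le k m hz)

theorem isDiscPolyanalytic_discMonomial {q k : ℕ} (hk : k < q) (m : ℕ) :
    IsDiscPolyanalytic q (discMonomial k m) := by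
  have := isDiscPolyanalytic_conj_pow_mul hk (h := fun z => z ^ m) (by fun_prop)
  simpa only [mul_comm] using! this

theorem discMonomial_mem_discBergman {α : ℝ} (hα : -1 < α) {q k : ℕ} (hk : k < q) (m : ℕ) :
    discMonomial k m ∈ discBergman α q :=
  ⟨isDiscPolyanalytic_discMonomial hk m, memLp_discMonomial hα k m⟩

/-- The density is positive on the disc, so equality holds Lebesgue-almost everywhere there, and
continuity does the rest. -/
theorem eqOn_disc_of_ae_eq {α : ℝ} {f g : ℂ → ℂ} (hf : ContinuousOn f disc)
    (hg : ContinuousOn g disc) (h : f =ᵐ[discMeasure α] g) : Set.EqOn f g disc := by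
  refine Measure.eqOn_open_of_ae_eq (μ := volume) ?_ isOpen_disc hf hg
  have h' := (ae_withDensity_iff ((measurable_discWeight α).ennreal_ofReal)).1 h
  filter_upwards [h', ae_restrict_mem measurableSet_disc] with z h1 hz
  exact h1 (by simpa using discWeight_pos α hz)

/-- The power series can be integrated termwise only on smaller discs, while orthogonality is known
on the whole disc; this limit connects the two. -/
theorem tendsto_integral_restrict_ball {α : ℝ} {F : ℂ → ℂ} (hF : Integrable F (discMeasure α)) :
    Filter.Tendsto (fun N : ℕ => ∫ z in Metric.ball 0 (1 - 1 / ((N : ℝ) + 1)), F z ∂discMeasure α)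
      Filter.atTop (nhds (∫ z, F z ∂discMeasure α)) := by
  have hU : (⋃ N : ℕ, Metric.ball (0 : ℂ) (1 - 1 / ((N : ℝ) + 1))) = disc := by
    ext z
    simp only [Set.mem_iUnion, mem_ball_zero_iff]
    constructor
    · rintro ⟨N, hN⟩
      have : (0 : ℝ) < 1 / ((N : ℝ) + 1) := by positivity
      exact show ‖z‖ < 1 by linarith
    · intro hz
      obtain ⟨N, hN⟩ := exists_nat_one_div_lt (show 0 < 1 - ‖z‖ from sub_pos.2 hz)
      exact ⟨N, by linarith⟩
  have h := tendsto_setIntegral_of_monotone (μ := discMeasure α) (f := F)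
    (s := fun N : ℕ => Metric.ball (0 : ℂ) (1 - 1 / ((N : ℝ) + 1)))
    (fun _ => measurableSet_ball) (fun M N hMN => Metric.ball_subset_ball (by
      have : (M : ℝ) ≤ N := by exact_mod_cast hMN
      gcongr)) hF.integrableOn
  rw [hU] at h
  have e : (discMeasure α).restrict disc = discMeasure α :=
    Measure.restrict_eq_self_of_ae_mem (ae_mem_disc α)
  rwa [e] at h

/-- A square integrable polyanalytic function orthogonal to all polyanalytic monomials vanishes. -/
theorem eq_zero_of_orthogonal_discMonomial {α : ℝ} (hα : -1 < α) {q : ℕ} {f : ℂ → ℂ}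
    (hf : f ∈ discBergman α q)
    (horth : ∀ k < q, ∀ m, ∫ z, f z * (starRingEnd ℂ) (discMonomial k m z) ∂discMeasure α = 0) :
    Set.EqOn f 0 disc := by
  have := isFiniteMeasure_discMeasure hα
  obtain ⟨hfq, hfL⟩ := hf
  obtain ⟨h, hh, hsum⟩ := hfq.exists_decomposition 0
  simp only [sub_zero] at hsum
  rw [disc_eq_ball] at hh
  choose a ha has using fun k => exists_power_series (hh k)
  -- `p d` collects the terms `z ^ (k + d) * conj z ^ k` of angular degree `d`. It is a finite sum
  -- of monomials, hence in `L²`, whereas the separate terms `conj z ^ k * h k` need not be. Where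
  -- `k + d < 0` the coefficient `B k d` is zero, so the default of `toNat` is harmless.
  set B : ℕ → ℤ → ℂ := fun k d => if 0 ≤ (k : ℤ) + d then a k ((k : ℤ) + d).toNat else 0 with hB
  set p : ℤ → ℂ → ℂ := fun d z =>
    ∑ k ∈ Finset.range q, B k d * discMonomial k ((k : ℤ) + d).toNat z with hp
  have hpc : ∀ d, Continuous (p d) := fun d =>
    continuous_finsetSum _ fun k _ => continuous_const.mul (continuous_discMonomial _ _)
  have hpL : ∀ d, MemLp (p d) 2 (discMeasure α) := fun d =>
    memLp_finsetSum _ fun k _ => (memLp_discMonomial hα _ _).const_mul _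
  have hfp : ∀ z ∈ disc, HasSum (fun d => p d z) (f z) := by
    intro z hz
    rw [hsum z hz]
    refine hasSum_sum fun k _ => ?_
    have h1 := (ha k z (by rwa [← disc_eq_ball])).mul_left ((starRingEnd ℂ) z ^ k)
    have hinj : Function.Injective fun m : ℕ => (m : ℤ) - k := fun m m' e => by
      simpa using e
    rw [← hinj.hasSum_iff]
    · convert! h1 using 2 with m
      simp [hB, discMonomial]
      ring
    · intro d hd
      have : ¬ 0 ≤ (k : ℤ) + d := fun h0 => hd ⟨((k : ℤ) + d).toNat, by
        simp only [Int.toNat_of_nonneg h0]; ring⟩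
      simp [hB, this]
  -- On a smaller disc a monomial of angular degree `d` sees only the component `p d` of `f`.
  have hJ : ∀ r : ℝ, r < 1 → ∀ (d : ℤ) (k' : ℕ), 0 ≤ (k' : ℤ) + d →
      ∫ z in Metric.ball 0 r, f z * (starRingEnd ℂ) (discMonomial k' ((k' : ℤ) + d).toNat z)
        ∂discMeasure α =
      ∫ z in Metric.ball 0 r, p d z * (starRingEnd ℂ) (discMonomial k' ((k' : ℤ) + d).toNat z)
        ∂discMeasure α := by
    intro r hr d k' hk'
    rcases le_or_gt r 0 with hr0 | hr0
    · simp [Metric.ball_eq_empty.2 hr0]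
    set μ := (discMeasure α).restrict (Metric.ball 0 r)
    have hμ : ∀ c : ℂ, ‖c‖ = 1 → MeasurePreserving (fun z : ℂ => c * z) μ μ := fun c hc =>
      measurePreserving_mul_restrict_ball hc r (measurePreserving_mul_discMeasure α hc)
    have hball : ∀ᵐ z ∂μ, ‖z‖ ≤ r := (ae_restrict_mem measurableSet_ball).mono
      fun z hz => (mem_ball_zero_iff.1 hz).le
    have hmem : ∀ᵐ z ∂μ, z ∈ disc := ae_restrict_of_ae (ae_mem_disc α)
    obtain ⟨m', hm'⟩ := Int.eq_ofNat_of_zero_le hk'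
    rw [hm', Int.toNat_natCast]
    have hterm := fun k => integral_holomorphic_mul_monomial hμ (ψ := fun _ => 1)
      (fun _ _ _ => rfl) (integrable_const 1) hr0.le hr hball (ha k) (has k r hr0.le hr)
      k' (k + m')
    have hintf : ∀ k, Integrable (fun z => h k z *
        (z ^ k' * (starRingEnd ℂ) z ^ (k + m') * 1)) μ := by
      intro k
      obtain ⟨C, hC⟩ := (isCompact_closedBall (0 : ℂ) r).exists_bound_of_continuousOn
        (f := fun z => h k z * (z ^ k' * (starRingEnd ℂ) z ^ (k + m') * 1)) (by
          refine ((hh k).continuousOn.mono (Metric.closedBall_subset_ball hr)).mul ?_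
          fun_prop)
      refine Integrable.of_bound ?_ C (hball.mono fun z hz => hC z (by simpa using hz))
      refine AEStronglyMeasurable.mul ?_ (by fun_prop : Continuous fun z : ℂ =>
        z ^ k' * (starRingEnd ℂ) z ^ (k + m') * 1).aestronglyMeasurable
      have h1 : AEStronglyMeasurable (h k) ((discMeasure α).restrict disc) := by
        rw [disc_eq_ball]
        exact (hh k).continuousOn.aestronglyMeasurable measurableSet_ball
      rw [Measure.restrict_eq_self_of_ae_mem (ae_mem_disc α)] at h1
      exact h1.restrict
    calc _ = ∫ z, ∑ k ∈ Finset.range q, h k z *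
            (z ^ k' * (starRingEnd ℂ) z ^ (k + m') * 1) ∂μ := by
          refine integral_congr_ae (hmem.mono fun z hz => ?_)
          simp only [hsum z hz, Finset.sum_mul, discMonomial, map_mul, map_pow, conj_conj]
          exact Finset.sum_congr rfl fun k _ => by ring
      _ = ∑ k ∈ Finset.range q, B k d * ∫ z, discMonomial k ((k : ℤ) + d).toNat z *
            (starRingEnd ℂ) (discMonomial k' m' z) ∂μ := by
          rw [integral_finsetSum _ fun k _ => hintf k]
          refine Finset.sum_congr rfl fun k _ => ?_
          rw [hterm k]
          rcases lt_or_ge ((k : ℤ) + d) 0 with hneg | hpos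
          · rw [if_neg (by omega)]
            simp [hB, not_le.2 hneg]
          · obtain ⟨m, hm⟩ := Int.eq_ofNat_of_zero_le hpos
            rw [if_pos (by omega)]
            have e1 : k + m' - k' = m := by omega
            simp only [hB, if_pos hpos, hm, Int.toNat_natCast, e1]
            congr 1
            refine integral_congr_ae (Filter.Eventually.of_forall fun z => ?_)
            have e2 : k + m' = m + k' := by omega
            simp only [discMonomial, map_mul, map_pow, conj_conj]
            rw [e2, mul_one]
            nth_rewrite 2 [← e2]
            ring
      _ = _ := by
          simp only [hp, Finset.sum_mul]
          rw [integral_finsetSum]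
          · refine Finset.sum_congr rfl fun k _ => ?_
            rw [← integral_const_mul]
            simp only [mul_assoc]
          · intro k _
            refine (MemLp.integrable_mul (p := 2) (q := 2)
              ((memLp_discMonomial hα _ _).const_mul _) ?_).restrict
            exact (memLp_discMonomial hα _ _).star
  have hnorm : ∀ r : ℝ, r < 1 → ∀ d : ℤ,
      ∫ z in Metric.ball 0 r, f z * (starRingEnd ℂ) (p d z) ∂discMeasure α =
      ∫ z in Metric.ball 0 r, p d z * (starRingEnd ℂ) (p d z) ∂discMeasure α := by
    intro r hr d
    have expand : ∀ F : ℂ → ℂ, MemLp F 2 (discMeasure α) →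
        ∫ z in Metric.ball 0 r, F z * (starRingEnd ℂ) (p d z) ∂discMeasure α =
        ∑ k ∈ Finset.range q, (starRingEnd ℂ) (B k d) * ∫ z in Metric.ball 0 r,
          F z * (starRingEnd ℂ) (discMonomial k ((k : ℤ) + d).toNat z) ∂discMeasure α := by
      intro F hF
      simp only [hp, map_sum, map_mul, Finset.mul_sum]
      rw [integral_finsetSum]
      · refine Finset.sum_congr rfl fun k _ => ?_
        rw [← integral_const_mul]
        simp only [mul_left_comm]
      · intro k _
        refine (MemLp.integrable_mul (p := 2) (q := 2) hF ?_).restrict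
        exact (memLp_discMonomial hα _ _).star.const_mul _
    rw [expand f hfL, expand _ (hpL d)]
    refine Finset.sum_congr rfl fun k _ => ?_
    by_cases h0 : 0 ≤ (k : ℤ) + d
    · rw [hJ r hr d k h0]
    · simp [hB, h0]
  -- As `r → 1`, `hnorm` becomes `⟨f, p d⟩ = ‖p d‖²`; the left side vanishes by hypothesis.
  have hp0 : ∀ d, Set.EqOn (p d) 0 disc := by
    intro d
    have hI1 : Integrable (fun z => f z * (starRingEnd ℂ) (p d z)) (discMeasure α) :=
      hfL.integrable_mul (hpL d).star
    have hI2 : Integrable (fun z => p d z * (starRingEnd ℂ) (p d z)) (discMeasure α) :=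
      (hpL d).integrable_mul (hpL d).star
    have ht1 := tendsto_integral_restrict_ball hI1
    have ht2 := tendsto_integral_restrict_ball hI2
    have hlt : ∀ N : ℕ, 1 - 1 / ((N : ℝ) + 1) < 1 := fun N => by
      have : (0 : ℝ) < 1 / ((N : ℝ) + 1) := by positivity
      linarith
    simp only [hnorm _ (hlt _) d] at ht1
    have heq := tendsto_nhds_unique ht2 ht1
    have hz : ∫ z, f z * (starRingEnd ℂ) (p d z) ∂discMeasure α = 0 := by
      simp only [hp, map_sum, map_mul, Finset.mul_sum]
      rw [integral_finsetSum]
      · refine Finset.sum_eq_zero fun k hk => ?_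
        simp only [mul_left_comm (f _)]
        rw [integral_const_mul, horth k (Finset.mem_range.1 hk), mul_zero]
      · intro k _
        refine MemLp.integrable_mul (p := 2) (q := 2) hfL ?_
        exact (memLp_discMonomial hα _ _).star.const_mul _
    rw [hz] at heq
    have hre : ∫ z, ‖p d z‖ ^ 2 ∂discMeasure α = 0 := by
      have e : ∀ z, p d z * (starRingEnd ℂ) (p d z) = ((‖p d z‖ ^ 2 : ℝ) : ℂ) := fun z => by
        rw [mul_conj, normSq_eq_norm_sq]
      simp only [e] at heq
      exact_mod_cast heq
    rw [integral_eq_zero_iff_of_nonneg (fun z => by positivity)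
      ((memLp_two_iff_integrable_sq_norm (hpL d).1).1 (hpL d))] at hre
    refine eqOn_disc_of_ae_eq (α := α) (hpc d).continuousOn continuousOn_const ?_
    filter_upwards [hre] with z hz
    simpa using hz
  intro z hz
  refine (hfp z hz).unique ?_
  convert! hasSum_zero using 2 with d
  exact hp0 d hz

/-! ### Local reproducing formula on the polydisc and convolutions -/

/-- The closed polydisc of radius `r`. -/
def closedPolydisc (n : ℕ) (r : ℝ) : Set (Fin n → ℂ) :=
  Set.univ.pi fun _ => Metric.closedBall 0 r

theorem isCompact_closedPolydisc (n : ℕ) (r : ℝ) : IsCompact (closedPolydisc n r) :=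
  isCompact_univ_pi fun _ => isCompact_closedBall _ _

theorem measurableSet_closedPolydisc (n : ℕ) (r : ℝ) : MeasurableSet (closedPolydisc n r) :=
  (isCompact_closedPolydisc n r).measurableSet

theorem closedPolydisc_subset {r : ℝ} (hr : r < 1) : closedPolydisc n r ⊆ polydisc n := by
  intro z hz j
  have := hz j (Set.mem_univ j)
  rw [mem_closedBall_zero_iff] at this
  exact this.trans_lt hr

theorem IsPolyanalytic.continuousOn {q : Fin n → ℕ} {f : (Fin n → ℂ) → ℂ}
    (hf : IsPolyanalytic q f) : ContinuousOn f (polydisc n) := hf.1.continuousOn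

/-- The one-variable formula is applied in each coordinate. As `‖w j‖ < 1 - 2 * ε`, the bump at `w
j` lives inside radius `1 - ε`, so truncating to the closed polydisc loses nothing and makes
everything bounded. -/
theorem IsPolyanalytic.setIntegral_mul_bump {q : Fin n → ℕ} {ε : ℝ} (hε : 0 < ε)
    {φ : Fin n → ℂ → ℂ} (hφ : ∀ j, IsReproducingBump (q j) ε (φ j)) {f : (Fin n → ℂ) → ℂ}
    (hf : IsPolyanalytic q f) {w : Fin n → ℂ} (hw : ∀ j, ‖w j‖ < 1 - 2 * ε) :
    ∫ z in closedPolydisc n (1 - ε), f z * ∏ j, φ j (w j - z j) = f w := by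
  have hr : 1 - ε < 1 := by linarith
  set S : Set ℂ := Metric.closedBall 0 (1 - ε)
  have hpi : (volume : Measure (Fin n → ℂ)).restrict (closedPolydisc n (1 - ε)) =
      Measure.pi fun _ => volume.restrict S := by
    rw [volume_pi, closedPolydisc, Measure.restrict_pi_pi]
  have hS : IsCompact S := isCompact_closedBall _ _
  have : IsFiniteMeasure ((volume : Measure ℂ).restrict S) :=
    isFiniteMeasure_restrict.2 hS.measure_lt_top.ne
  have hSd : ∀ z : Fin n → ℂ, (∀ i, z i ∈ S) → z ∈ polydisc n := fun z hz =>
    closedPolydisc_subset hr fun i _ => hz i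
  rw [hpi]
  refine (eq_integral_prod_of_separately (fun _ => volume.restrict S) (fun _ => S)
    (fun j t => φ j (w j - t)) w f (fun _ => ae_restrict_mem hS.measurableSet) (fun j => ?_)
    (fun j => ?_) ?_ fun j z hz _ => ?_).symm
  · rw [mem_closedBall_zero_iff]
    linarith [hw j]
  · have hc : Continuous fun t => φ j (w j - t) :=
      (hφ j).contDiff.continuous.comp (continuous_const.sub continuous_id)
    obtain ⟨C, hC⟩ := hS.exists_bound_of_continuousOn hc.continuousOn
    exact MemLp.of_bound hc.aestronglyMeasurable C
      ((ae_restrict_mem hS.measurableSet).mono fun t ht => hC t ht)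
  · rw [← hpi]
    have hc : ContinuousOn f (closedPolydisc n (1 - ε)) :=
      hf.continuousOn.mono (closedPolydisc_subset hr)
    obtain ⟨C, hC⟩ := (isCompact_closedPolydisc n (1 - ε)).exists_bound_of_continuousOn hc
    have : IsFiniteMeasure
        ((volume : Measure (Fin n → ℂ)).restrict (closedPolydisc n (1 - ε))) :=
      isFiniteMeasure_restrict.2 (isCompact_closedPolydisc n (1 - ε)).measure_lt_top.ne
    exact MemLp.of_bound (hc.aestronglyMeasurable (measurableSet_closedPolydisc _ _)) C
      ((ae_restrict_mem (measurableSet_closedPolydisc _ _)).mono fun t ht => hC t ht)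
  · rw [setIntegral_eq_integral_of_forall_compl_eq_zero,
      (hf.slice (hSd z hz) j).integral_mul_bump hε (hφ j) (by linarith [hw j])]
    intro t ht
    rw [mem_closedBall_zero_iff, not_le] at ht
    rw [(hφ j).eq_zero, mul_zero]
    have := norm_sub_norm_le t (w j)
    rw [norm_sub_rev] at this
    linarith [hw j]

/-! ### The operators `∂/∂z̄ⱼ` and convolution -/

theorem contDiff_dbar (j : Fin n) {Φ : (Fin n → ℂ) → ℂ} (hΦ : ContDiff ℝ ∞ Φ) :
    ContDiff ℝ ∞ (dbar j Φ) := by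
  have h : ContDiff ℝ ∞ (fderiv ℝ Φ) := hΦ.fderiv_right (by simp)
  exact contDiff_const.mul ((h.clm_apply contDiff_const).add
    (contDiff_const.mul (h.clm_apply contDiff_const)))

theorem hasCompactSupport_dbar (j : Fin n) {Φ : (Fin n → ℂ) → ℂ} (hΦ : HasCompactSupport Φ) :
    HasCompactSupport (dbar j Φ) := by
  have h1 := hΦ.fderiv_apply ℝ (Pi.single j 1 : Fin n → ℂ)
  have h2 := hΦ.fderiv_apply ℝ (Pi.single j I : Fin n → ℂ)
  exact (h1.add h2.mul_left).mul_left

theorem dbar_convolution (j : Fin n) {g Φ : (Fin n → ℂ) → ℂ} (hg : LocallyIntegrable g volume)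
    (hΦ : ContDiff ℝ ∞ Φ) (hΦc : HasCompactSupport Φ) :
    dbar j (convolution g Φ (ContinuousLinearMap.mul ℝ ℂ) volume) =
      convolution g (dbar j Φ) (ContinuousLinearMap.mul ℝ ℂ) volume := by
  funext x
  have hd := hΦc.hasFDerivAt_convolution_right (ContinuousLinearMap.mul ℝ ℂ) hg
    (hΦ.of_le (by simp)) x
  have hfc : Continuous (fderiv ℝ Φ) := hΦ.continuous_fderiv (by simp)
  have happ := fun v => convolution_precompR_apply (ContinuousLinearMap.mul ℝ ℂ) hg
    (hΦc.fderiv ℝ) hfc x v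
  have hint : ∀ v, Integrable fun t => g t * fderiv ℝ Φ (x - t) v := fun v =>
    (hΦc.fderiv_apply ℝ v).convolutionExists_right (ContinuousLinearMap.mul ℝ ℂ) hg
      (by fun_prop) x
  simp only [dbar, hd.fderiv, happ]
  simp only [convolution_def, ContinuousLinearMap.mul_apply']
  rw [← integral_const_mul, ← integral_add (hint _) ((hint _).const_mul _), ← integral_const_mul]
  refine integral_congr_ae (Filter.Eventually.of_forall fun t => ?_)
  simp only [dbar]
  ring

theorem contDiff_dbar_iterate (j : Fin n) (k : ℕ) {Φ : (Fin n → ℂ) → ℂ} (hΦ : ContDiff ℝ ∞ Φ) :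
    ContDiff ℝ ∞ ((dbar j)^[k] Φ) := by
  induction k with
  | zero => exact hΦ
  | succ k ih => rw [Function.iterate_succ_apply']; exact contDiff_dbar j ih

theorem hasCompactSupport_dbar_iterate (j : Fin n) (k : ℕ) {Φ : (Fin n → ℂ) → ℂ}
    (hΦ : HasCompactSupport Φ) : HasCompactSupport ((dbar j)^[k] Φ) := by
  induction k with
  | zero => exact hΦ
  | succ k ih => rw [Function.iterate_succ_apply']; exact hasCompactSupport_dbar j ih

theorem dbar_iterate_convolution (j : Fin n) (k : ℕ) {g Φ : (Fin n → ℂ) → ℂ}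
    (hg : LocallyIntegrable g volume) (hΦ : ContDiff ℝ ∞ Φ) (hΦc : HasCompactSupport Φ) :
    (dbar j)^[k] (convolution g Φ (ContinuousLinearMap.mul ℝ ℂ) volume) =
      convolution g ((dbar j)^[k] Φ) (ContinuousLinearMap.mul ℝ ℂ) volume := by
  induction k with
  | zero => rfl
  | succ k ih =>
    rw [Function.iterate_succ_apply', ih, dbar_convolution j hg (contDiff_dbar_iterate j k hΦ)
      (hasCompactSupport_dbar_iterate j k hΦc), Function.iterate_succ_apply']

theorem dbar_iterate_congr_of_isOpen (j : Fin n) (k : ℕ) {U : Set (Fin n → ℂ)} (hU : IsOpen U)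
    {f g : (Fin n → ℂ) → ℂ} (h : Set.EqOn f g U) :
    Set.EqOn ((dbar j)^[k] f) ((dbar j)^[k] g) U := by
  induction k with
  | zero => exact h
  | succ k ih =>
    intro z hz
    have : (dbar j)^[k] f =ᶠ[nhds z] (dbar j)^[k] g := ih.eventuallyEq_of_mem (hU.mem_nhds hz)
    simp only [Function.iterate_succ_apply', dbar, this.fderiv_eq]

/-! ### Integrals over closed polydiscs as inner products -/

theorem polydiscWeight_pos (α : ℝ) {z : Fin n → ℂ} (hz : z ∈ polydisc n) :
    0 < polydiscWeight n α z :=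
  Finset.prod_pos fun j _ => discWeight_pos α (hz j)

theorem continuousOn_polydiscWeight (n : ℕ) (α : ℝ) :
    ContinuousOn (polydiscWeight n α) (polydisc n) := by
  refine continuousOn_finsetProd _ fun j _ => continuousOn_const.mul ?_
  refine ContinuousOn.rpow_const (by fun_prop) fun z hz => Or.inl ?_
  exact (one_sub_norm_sq_pos (hz j)).ne'

/-- The function representing `F ↦ ∫ z in closedPolydisc n r, F z * G z` on `L²`. -/
def localKernel (α : ℝ) (r : ℝ) (G : (Fin n → ℂ) → ℂ) : (Fin n → ℂ) → ℂ :=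
  (closedPolydisc n r).indicator fun z => G z / polydiscWeight n α z

/-- On the compact polydisc of radius `r < 1` the weight is continuous and positive, so the quotient
is bounded, and the measure is finite. -/
theorem memLp_localKernel {α : ℝ} (hα : -1 < α) {r : ℝ} (hr : r < 1) {G : (Fin n → ℂ) → ℂ}
    (hG : Continuous G) : MemLp (localKernel α r G) 2 (polydiscMeasure n α) := by
  have := isFiniteMeasure_polydiscMeasure (n := n) hα
  have hc : ContinuousOn (fun z => G z / polydiscWeight n α z) (closedPolydisc n r) := by
    refine hG.continuousOn.div ?_ fun z hz => ?_
    · exact continuous_ofReal.comp_continuousOn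
        ((continuousOn_polydiscWeight n α).mono (closedPolydisc_subset hr))
    · exact_mod_cast (polydiscWeight_pos α (closedPolydisc_subset hr hz)).ne'
  obtain ⟨C, hC⟩ := (isCompact_closedPolydisc n r).exists_bound_of_continuousOn hc
  refine MemLp.of_bound ?_ (max C 0) (Filter.Eventually.of_forall fun z => ?_)
  · refine Measurable.aestronglyMeasurable ?_
    exact (hG.measurable.div (measurable_ofReal.comp (measurable_polydiscWeight n α))).indicator
      (measurableSet_closedPolydisc n r)
  · by_cases hz : z ∈ closedPolydisc n r
    · rw [localKernel, Set.indicator_of_mem hz]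
      exact (hC z hz).trans (le_max_left _ _)
    · rw [localKernel, Set.indicator_of_notMem hz, norm_zero]
      exact le_max_right _ _

theorem weight_smul_mul_localKernel {α : ℝ} {r : ℝ} (hr : r < 1) (F G : (Fin n → ℂ) → ℂ)
    (z : Fin n → ℂ) : (ENNReal.ofReal (polydiscWeight n α z)).toReal • (F z * localKernel α r G z) =
      (closedPolydisc n r).indicator (fun z => F z * G z) z := by
  by_cases hz : z ∈ closedPolydisc n r
  · have hpos := polydiscWeight_pos α (closedPolydisc_subset hr hz)
    have hne : (polydiscWeight n α z : ℂ) ≠ 0 := by exact_mod_cast hpos.ne'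
    rw [localKernel, Set.indicator_of_mem hz, Set.indicator_of_mem hz,
      ENNReal.toReal_ofReal hpos.le, real_smul]
    field_simp
  · rw [localKernel, Set.indicator_of_notMem hz, Set.indicator_of_notMem hz, mul_zero, smul_zero]

theorem restrict_polydisc_closedPolydisc {r : ℝ} (hr : r < 1) :
    ((volume : Measure (Fin n → ℂ)).restrict (polydisc n)).restrict (closedPolydisc n r) =
      volume.restrict (closedPolydisc n r) := by
  rw [Measure.restrict_restrict (measurableSet_closedPolydisc n r),
    Set.inter_eq_left.2 (closedPolydisc_subset hr)]

theorem integral_mul_localKernel {α : ℝ} {r : ℝ} (hr : r < 1) (F G : (Fin n → ℂ) → ℂ) :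
    ∫ z, F z * localKernel α r G z ∂polydiscMeasure n α =
      ∫ z in closedPolydisc n r, F z * G z := by
  rw [polydiscMeasure_def, integral_withDensity_eq_integral_toReal_smul
    (measurable_polydiscWeight n α).ennreal_ofReal (by simp)]
  simp only [weight_smul_mul_localKernel hr]
  rw [integral_indicator (measurableSet_closedPolydisc n r), restrict_polydisc_closedPolydisc hr]

theorem integrableOn_closedPolydisc {α : ℝ} (hα : -1 < α) {r : ℝ} (hr : r < 1)
    {F : (Fin n → ℂ) → ℂ} (hF : MemLp F 2 (polydiscMeasure n α)) :
    IntegrableOn F (closedPolydisc n r) := by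
  have h : Integrable (fun z => F z * localKernel α r (fun _ => 1) z) (polydiscMeasure n α) :=
    hF.integrable_mul (memLp_localKernel hα hr continuous_const)
  rw [polydiscMeasure_def, integrable_withDensity_iff_integrable_smul'
    (measurable_polydiscWeight n α).ennreal_ofReal (by simp)] at h
  simp only [weight_smul_mul_localKernel hr, mul_one] at h
  rwa [integrable_indicator_iff (measurableSet_closedPolydisc n r), IntegrableOn,
    restrict_polydisc_closedPolydisc hr] at h

theorem continuous_integral_mul {X : Type*} [MeasurableSpace X] {μ : Measure X} {k : X → ℂ}
    (hk : MemLp k 2 μ) : Continuous fun F : Lp ℂ 2 μ => ∫ z, F z * k z ∂μ := by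
  have h : (fun F : Lp ℂ 2 μ => ∫ z, F z * k z ∂μ) = fun F => inner ℂ (hk.star.toLp) F := by
    funext F
    rw [L2.inner_def]
    refine integral_congr_ae ?_
    filter_upwards [hk.star.coeFn_toLp] with z hz
    rw [hz]
    simp [RCLike.inner_apply]
  rw [h]
  fun_prop

theorem isOpen_setOf_norm_lt (r : ℝ) : IsOpen {w : Fin n → ℂ | ∀ j, ‖w j‖ < r} := by
  simp only [Set.ofPred_forall]
  exact isOpen_iInter_of_finite fun j =>
    isOpen_lt (continuous_norm.comp (continuous_apply j)) continuous_const

theorem exists_forall_norm_lt {w : Fin n → ℂ} (hw : w ∈ polydisc n) :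
    ∃ ε : ℝ, 0 < ε ∧ ∀ j, ‖w j‖ < 1 - 2 * ε := by
  have h : ∀ s : Finset (Fin n), ∃ ε : ℝ, 0 < ε ∧ ∀ j ∈ s, ‖w j‖ < 1 - 2 * ε := by
    intro s
    induction s using Finset.induction_on with
    | empty => exact ⟨1, one_pos, by simp⟩
    | insert i s hi ih =>
      obtain ⟨ε, hε, h⟩ := ih
      have hwi : ‖w i‖ < 1 := hw i
      refine ⟨min ε ((1 - ‖w i‖) / 3), lt_min hε (by linarith), fun j hj => ?_⟩
      have h1 := min_le_left ε ((1 - ‖w i‖) / 3)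
      have h2 := min_le_right ε ((1 - ‖w i‖) / 3)
      rcases Finset.mem_insert.1 hj with rfl | hj
      · linarith
      · linarith [h j hj]
  obtain ⟨ε, hε, h'⟩ := h Finset.univ
  exact ⟨ε, hε, fun j => h' j (Finset.mem_univ j)⟩

/-- Point evaluations on the polyanalytic Bergman space are given by integration against a
square integrable function. -/
theorem exists_representing_evaluation {α : ℝ} (hα : -1 < α) (q : Fin n → ℕ) {w : Fin n → ℂ}
    (hw : w ∈ polydisc n) : ∃ k : (Fin n → ℂ) → ℂ, MemLp k 2 (polydiscMeasure n α) ∧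
      ∀ f ∈ bergman α q, f w = ∫ z, f z * k z ∂polydiscMeasure n α := by
  obtain ⟨ε, hε, hwε⟩ := exists_forall_norm_lt hw
  choose φ hφ using fun j => exists_isReproducingBump (q j) hε
  refine ⟨localKernel α (1 - ε) fun z => ∏ j, φ j (w j - z j),
    memLp_localKernel hα (by linarith) ?_, fun f hf => ?_⟩
  · exact continuous_finsetProd _ fun j _ => (hφ j).contDiff.continuous.comp (by fun_prop)
  · rw [integral_mul_localKernel (by linarith), hf.1.setIntegral_mul_bump hε hφ hwε]

/-! ### Completeness -/

/-- Locally, the limits of polyanalytic functions that converge in `L²` are smooth and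
polyanalytic. -/
theorem exists_local_limit {α : ℝ} (hα : -1 < α) (q : Fin n → ℕ) {ε : ℝ} (hε : 0 < ε)
    {f : ℕ → (Fin n → ℂ) → ℂ} (hf : ∀ N, f N ∈ bergman α q)
    {F : ℕ → Lp ℂ 2 (polydiscMeasure n α)} (hFf : ∀ N, F N =ᵐ[polydiscMeasure n α] f N)
    {F' : Lp ℂ 2 (polydiscMeasure n α)} (hF : Filter.Tendsto F Filter.atTop (nhds F')) :
    ∃ G : (Fin n → ℂ) → ℂ, ContDiff ℝ ∞ G ∧
      ∀ w : Fin n → ℂ, (∀ j, ‖w j‖ < 1 - 2 * ε) →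
        Filter.Tendsto (fun N => f N w) Filter.atTop (nhds (G w)) ∧
        ∀ j, (dbar j)^[q j] G w = 0 := by
  choose φ hφ using fun j => exists_isReproducingBump (q j) hε
  have hr : 1 - ε < 1 := by linarith
  set Φ : (Fin n → ℂ) → ℂ := fun z => ∏ j, φ j (z j) with hΦ
  set L := ContinuousLinearMap.mul ℝ ℂ
  have hΦs : ContDiff ℝ ∞ Φ := contDiff_prod fun j _ =>
    (hφ j).contDiff.comp (contDiff_apply ℝ ℂ j)
  have hΦc : HasCompactSupport Φ := by
    refine HasCompactSupport.intro (isCompact_closedPolydisc n ε) fun z hz => ?_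
    simp only [closedPolydisc, Set.mem_univ_pi, not_forall, mem_closedBall_zero_iff, not_le] at hz
    obtain ⟨j, hj⟩ := hz
    exact Finset.prod_eq_zero (Finset.mem_univ j) ((hφ j).eq_zero _ hj.le)
  set cut : ((Fin n → ℂ) → ℂ) → (Fin n → ℂ) → ℂ := fun H =>
    (closedPolydisc n (1 - ε)).indicator H with hcut
  have hcutint : ∀ H, MemLp H 2 (polydiscMeasure n α) → LocallyIntegrable (cut H) volume := by
    intro H hH
    exact ((integrable_indicator_iff (measurableSet_closedPolydisc n _)).2
      (integrableOn_closedPolydisc hα hr hH)).locallyIntegrable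
  -- Each value of the convolution is a pairing with a fixed `L²` function, hence continuous for
  -- `L²` convergence.
  have hconv : ∀ (H Ψ : (Fin n → ℂ) → ℂ) (w : Fin n → ℂ), convolution (cut H) Ψ L volume w =
      ∫ z, H z * localKernel α (1 - ε) (fun z => Ψ (w - z)) z ∂polydiscMeasure n α := by
    intro H Ψ w
    rw [integral_mul_localKernel hr, convolution_def,
      ← integral_indicator (measurableSet_closedPolydisc n _)]
    refine integral_congr_ae (Filter.Eventually.of_forall fun z => ?_)
    by_cases hz : z ∈ closedPolydisc n (1 - ε) <;> simp [L, hcut, hz]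
  have hlim : ∀ (Ψ : (Fin n → ℂ) → ℂ), Continuous Ψ → ∀ w, Filter.Tendsto
      (fun N => convolution (cut (f N)) Ψ L volume w) Filter.atTop
      (nhds (convolution (cut F') Ψ L volume w)) := by
    intro Ψ hΨ w
    simp only [hconv]
    have hk := memLp_localKernel (α := α) hα hr (G := fun z => Ψ (w - z)) (by fun_prop)
    have := ((continuous_integral_mul hk).tendsto F').comp hF
    refine this.congr fun N => integral_congr_ae ?_
    filter_upwards [hFf N] with z hz
    rw [hz]
  have hloc : ∀ N, ∀ w : Fin n → ℂ, (∀ j, ‖w j‖ < 1 - 2 * ε) →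
      convolution (cut (f N)) Φ L volume w = f N w := by
    intro N w hw
    rw [hconv, integral_mul_localKernel hr, ← (hf N).1.setIntegral_mul_bump hε hφ hw]
    rfl
  refine ⟨convolution (cut F') Φ L volume,
    hΦc.contDiff_convolution_right (n := ⊤) L (hcutint _ (Lp.memLp F')) hΦs, fun w hw => ⟨?_, ?_⟩⟩
  · exact (hlim Φ hΦs.continuous w).congr fun N => hloc N w hw
  · intro j
    -- The derivatives fall on `Φ`, so this value is the limit of the same expression for `f N`.
    -- There the convolution is `f N` itself near `w`, and its derivative vanishes.
    rw [dbar_iterate_convolution j _ (hcutint _ (Lp.memLp F')) hΦs hΦc]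
    refine tendsto_nhds_unique (hlim _ (contDiff_dbar_iterate j _ hΦs).continuous w) ?_
    refine tendsto_const_nhds.congr fun N => ?_
    rw [← dbar_iterate_convolution j _ (hcutint _ (hf N).2) hΦs hΦc,
      dbar_iterate_congr_of_isOpen j (q j) (isOpen_setOf_norm_lt _) (fun z hz => hloc N z hz) hw]
    refine ((hf N).1.2 j w fun i => (hw i).trans ?_).symm
    linarith

theorem isClosed_bergmanL2 {α : ℝ} (hα : -1 < α) (q : Fin n → ℕ) :
    IsClosed (bergmanL2 α q : Set (Lp ℂ 2 (polydiscMeasure n α))) := by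
  refine IsSeqClosed.isClosed fun F F' hF hlim => ?_
  choose f hf hFf using hF
  choose! ε hε hwε using fun w (hw : w ∈ polydisc n) => exists_forall_norm_lt hw
  have hG := fun w (hw : w ∈ polydisc n) => exists_local_limit hα q (hε w hw) hf hFf hlim
  choose! G hGs hGl using hG
  -- The local limits glue because each is the pointwise limit of `f N` on its own neighbourhood.
  -- The `L²` limit equals `g` through an almost everywhere convergent subsequence.
  set g : (Fin n → ℂ) → ℂ := fun w => G w w
  have hgl : ∀ w ∈ polydisc n, Filter.Tendsto (fun N => f N w) Filter.atTop (nhds (g w)) :=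
    fun w hw => (hGl w hw w (hwε w hw)).1
  have heq : ∀ w ∈ polydisc n, Set.EqOn g (G w) {v | ∀ j, ‖v j‖ < 1 - 2 * ε w} := by
    intro w hw v hv
    have hvp : v ∈ polydisc n := fun j => (hv j).trans (by linarith [hε w hw])
    exact tendsto_nhds_unique (hgl v hvp) (hGl w hw v hv).1
  have hpoly : IsPolyanalytic q g := by
    refine ⟨fun w hw => ContDiffAt.contDiffWithinAt ?_, fun j w hw => ?_⟩
    · exact ((hGs w hw).of_le (by exact_mod_cast le_top)).contDiffAt.congr_of_eventuallyEq
        ((heq w hw).eventuallyEq_of_mem ((isOpen_setOf_norm_lt _).mem_nhds (hwε w hw)))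
    · rw [dbar_iterate_congr_of_isOpen j (q j) (isOpen_setOf_norm_lt _) (heq w hw) (hwε w hw)]
      exact (hGl w hw w (hwε w hw)).2 j
  have hae : F' =ᵐ[polydiscMeasure n α] g := by
    obtain ⟨ns, hns, hns2⟩ := (tendstoInMeasure_of_tendsto_Lp hlim).exists_seq_tendsto_ae
    filter_upwards [hns2, ae_all_iff.2 hFf, ae_mem_polydisc n α] with z h1 h2 h3
    simp only [h2] at h1
    exact tendsto_nhds_unique h1 ((hgl z h3).comp hns.tendsto_atTop)
  exact ⟨g, ⟨hpoly, (memLp_congr_ae hae).1 (Lp.memLp F')⟩, hae⟩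

theorem completeSpace_bergmanL2 {α : ℝ} (hα : -1 < α) (q : Fin n → ℕ) :
    CompleteSpace (bergmanL2 α q) :=
  (isClosed_bergmanL2 hα q).completeSpace_coe

/-- The reproducing kernel of the polyanalytic Bergman space exists. -/
theorem exists_bergman_kernel {α : ℝ} (hα : -1 < α) (q : Fin n → ℕ) {w : Fin n → ℂ}
    (hw : w ∈ polydisc n) : ∃ k ∈ bergman α q,
      ∀ f ∈ bergman α q, f w = ∫ z, f z * (starRingEnd ℂ) (k z) ∂polydiscMeasure n α := by
  have := completeSpace_bergmanL2 hα q
  obtain ⟨k, hk, hrep⟩ := exists_representing_evaluation hα q hw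
  -- The conjugate of `k` need not lie in the space; its orthogonal projection does and has the same
  -- inner products with all members.
  set P := (bergmanL2 α q).starProjection (hk.star.toLp) with hP
  obtain ⟨κ, hκ, hPκ⟩ : P ∈ bergmanL2 α q := Submodule.starProjection_apply_mem _ _
  refine ⟨κ, hκ, fun f hf => ?_⟩
  have hfm : hf.2.toLp ∈ bergmanL2 α q := ⟨f, hf, hf.2.coeFn_toLp⟩
  have hin : inner ℂ (hk.star.toLp) hf.2.toLp = inner ℂ P hf.2.toLp := by
    rw [hP, Submodule.inner_starProjection_left_eq_right,
      Submodule.starProjection_eq_self_iff.2 hfm]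
  rw [L2.inner_def, L2.inner_def] at hin
  rw [hrep f hf]
  refine Eq.trans ?_ (hin.trans ?_)
  · refine integral_congr_ae ?_
    filter_upwards [hk.star.coeFn_toLp, hf.2.coeFn_toLp] with z h1 h2
    rw [h1, h2]
    simp [RCLike.inner_apply]
  · refine integral_congr_ae ?_
    filter_upwards [hPκ, hf.2.coeFn_toLp] with z h1 h2
    rw [h1, h2]
    simp [RCLike.inner_apply]

/-! ### One variable as a special case of several variables -/

theorem measurePreserving_apply_zero {α : ℝ} (hα : -1 < α) :
    MeasurePreserving (fun z : Fin 1 → ℂ => z 0) (polydiscMeasure 1 α) (discMeasure α) := by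
  rw [polydiscMeasure_eq_pi hα]
  exact measurePreserving_funUnique (discMeasure α) (Fin 1)

theorem measurePreserving_const {α : ℝ} (hα : -1 < α) :
    MeasurePreserving (fun (t : ℂ) (_ : Fin 1) => t) (discMeasure α) (polydiscMeasure 1 α) := by
  rw [polydiscMeasure_eq_pi hα]
  exact (measurePreserving_funUnique (discMeasure α) (Fin 1)).symm

theorem integral_comp_const {α : ℝ} (hα : -1 < α) (F : (Fin 1 → ℂ) → ℂ) :
    ∫ t, F (fun _ => t) ∂discMeasure α = ∫ z, F z ∂polydiscMeasure 1 α :=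
  (measurePreserving_const hα).integral_comp
    (MeasurableEquiv.funUnique (Fin 1) ℂ).symm.measurableEmbedding F

theorem comp_apply_zero_mem_bergman {α : ℝ} (hα : -1 < α) {q : ℕ} {g : ℂ → ℂ}
    (hg : g ∈ discBergman α q) :
    (fun z : Fin 1 → ℂ => g (z 0)) ∈ bergman α (fun _ : Fin 1 => q) := by
  refine ⟨?_, hg.2.comp_measurePreserving (measurePreserving_apply_zero hα)⟩
  simpa using isPolyanalytic_prod (q := fun _ : Fin 1 => q) (g := fun _ => g) fun _ => hg.1

theorem comp_const_mem_discBergman {α : ℝ} (hα : -1 < α) {q : ℕ} {f : (Fin 1 → ℂ) → ℂ}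
    (hf : f ∈ bergman α (fun _ : Fin 1 => q)) :
    (fun t => f fun _ => t) ∈ discBergman α q := by
  refine ⟨?_, hf.2.comp_measurePreserving (measurePreserving_const hα)⟩
  have h := hf.1.slice (z := 0) (fun j => by simp) 0
  have e : ∀ t : ℂ, Function.update (0 : Fin 1 → ℂ) 0 t = fun _ => t := fun t => by
    ext j; rw [Subsingleton.elim j 0, Function.update_self]
  simpa only [e] using h

theorem exists_isDiscBergmanKernel {α : ℝ} (hα : -1 < α) (q : ℕ) :
    ∃ K, IsDiscBergmanKernel α q K := by
  have h : ∀ w ∈ disc, ∃ k ∈ discBergman α q, ∀ f ∈ discBergman α q,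
      f w = ∫ z, f z * (starRingEnd ℂ) (k z) ∂discMeasure α := by
    intro w hw
    obtain ⟨k, hk, hrep⟩ := exists_bergman_kernel hα (fun _ : Fin 1 => q) (w := fun _ => w)
      fun _ => hw
    refine ⟨_, comp_const_mem_discBergman hα hk, fun f hf => ?_⟩
    rw [hrep _ (comp_apply_zero_mem_bergman hα hf), ← integral_comp_const hα]
  choose! k hk hrep using h
  exact ⟨fun z w => k w z, fun w hw => ⟨hk w hw, hrep w hw⟩⟩

/-- The classes in `L²` of the polyanalytic monomials on the disc. -/
def discMonomials (α : ℝ) (q : ℕ) : Set (Lp ℂ 2 (discMeasure α)) :=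
  {F | ∃ k < q, ∃ m, F =ᵐ[discMeasure α] discMonomial k m}

theorem integral_mul_conj_eq_inner {X : Type*} [MeasurableSpace X] {μ : Measure X} {f g : X → ℂ}
    {F G : Lp ℂ 2 μ} (hF : F =ᵐ[μ] f) (hG : G =ᵐ[μ] g) :
    ∫ z, f z * (starRingEnd ℂ) (g z) ∂μ = inner ℂ G F := by
  rw [L2.inner_def]
  refine integral_congr_ae ?_
  filter_upwards [hF, hG] with z h1 h2
  rw [h1, h2, RCLike.inner_apply]

/-- Subtract the projection onto the closed span `W`. The remainder is still a class of a
polyanalytic function, because the space is closed, and it is orthogonal to all monomials, hence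
zero. -/
theorem toLp_mem_closure_discMonomials {α : ℝ} (hα : -1 < α) {q : ℕ} {g : ℂ → ℂ}
    (hg : g ∈ discBergman α q) :
    hg.2.toLp ∈ (Submodule.span ℂ (discMonomials α q)).topologicalClosure := by
  set W := (Submodule.span ℂ (discMonomials α q)).topologicalClosure with hW
  have : CompleteSpace W :=
    (Submodule.isClosed_topologicalClosure _).completeSpace_coe
  have hmp := measurePreserving_apply_zero hα
  set C := Lp.compMeasurePreservingₗᵢ ℂ (E := ℂ) (p := 2) _ hmp with hC
  have hCae : ∀ F : Lp ℂ 2 (discMeasure α),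
      C F =ᵐ[polydiscMeasure 1 α] fun z => F (z 0) := fun F =>
    Lp.coeFn_compMeasurePreserving F hmp
  -- The one-variable space is realised as a preimage under an isometry, so that its closedness is
  -- inherited from the case `n = 1`.
  set D := (bergmanL2 α (fun _ : Fin 1 => q)).comap C.toLinearMap with hD
  have hDmem : ∀ {F : Lp ℂ 2 (discMeasure α)} {f : ℂ → ℂ}, f ∈ discBergman α q →
      F =ᵐ[discMeasure α] f → F ∈ D := by
    intro F f hf hFf
    refine ⟨_, comp_apply_zero_mem_bergman hα hf, (hCae F).trans ?_⟩
    exact hmp.quasiMeasurePreserving.ae_eq_comp hFf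
  have hDclosed : IsClosed (D : Set (Lp ℂ 2 (discMeasure α))) :=
    (isClosed_bergmanL2 hα _).preimage C.continuous
  have hWD : W ≤ D := by
    refine Submodule.topologicalClosure_minimal _ (Submodule.span_le.2 ?_) hDclosed
    rintro F ⟨k, hk, m, hF⟩
    exact hDmem (discMonomial_mem_discBergman hα hk m) hF
  set F := hg.2.toLp with hF
  have hFD : F ∈ D := hDmem hg hg.2.coeFn_toLp
  set H := F - W.starProjection F with hH
  have hHD : H ∈ D := D.sub_mem hFD (hWD (Submodule.starProjection_apply_mem _ _))
  have hHW : H ∈ Wᗮ := Submodule.sub_starProjection_mem_orthogonal F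
  obtain ⟨f, hf, hHf⟩ := hHD
  have hHh : H =ᵐ[discMeasure α] fun t => f fun _ => t := by
    have h1 := (measurePreserving_const hα).quasiMeasurePreserving.ae_eq_comp
      ((hCae H).symm.trans hHf)
    exact h1
  have hzero : Set.EqOn (fun t => f fun _ => t) 0 disc := by
    refine eq_zero_of_orthogonal_discMonomial hα (comp_const_mem_discBergman hα hf)
      fun k hk m => ?_
    rw [integral_mul_conj_eq_inner hHh (memLp_discMonomial hα k m).coeFn_toLp]
    exact (Submodule.mem_orthogonal _ _).1 hHW _ (Submodule.le_topologicalClosure _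
      (Submodule.subset_span ⟨k, hk, m, (memLp_discMonomial hα k m).coeFn_toLp⟩))
  have hH0 : H = 0 := by
    refine Lp.ext (hHh.trans ?_)
    filter_upwards [ae_mem_disc α, Lp.coeFn_zero ℂ 2 (discMeasure α)] with z hz h0
    rw [h0]
    exact hzero hz
  have : F = W.starProjection F := sub_eq_zero.1 hH0
  rw [this]
  exact Submodule.starProjection_apply_mem _ _

/-! ### Products in `L²` -/

theorem memLp_two_prod {α : ℝ} (hα : -1 < α) {g : Fin n → ℂ → ℂ}
    (hg : ∀ j, MemLp (g j) 2 (discMeasure α)) :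
    MemLp (fun z : Fin n → ℂ => ∏ j, g j (z j)) 2 (polydiscMeasure n α) := by
  have := isFiniteMeasure_discMeasure hα
  rw [polydiscMeasure_eq_pi hα]
  exact memLp_prod_apply hg

/-- The product of functions of one variable, in `L²`. -/
def tensorLp {α : ℝ} (hα : -1 < α) (g : Fin n → Lp ℂ 2 (discMeasure α)) :
    Lp ℂ 2 (polydiscMeasure n α) :=
  (memLp_two_prod hα fun j => Lp.memLp (g j)).toLp

theorem ae_apply {α : ℝ} (hα : -1 < α) (j : Fin n) {p : ℂ → Prop} (hp : ∀ᵐ z ∂discMeasure α, p z) :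
    ∀ᵐ z ∂polydiscMeasure n α, p (z j) := by
  have := isFiniteMeasure_discMeasure hα
  rw [polydiscMeasure_eq_pi hα]
  exact (Measure.tendsto_eval_ae_ae (μ := fun _ : Fin n => discMeasure α) (i := j)).eventually hp

theorem coeFn_tensorLp {α : ℝ} (hα : -1 < α) {g : Fin n → Lp ℂ 2 (discMeasure α)}
    {f : Fin n → ℂ → ℂ} (hf : ∀ j, g j =ᵐ[discMeasure α] f j) :
    tensorLp hα g =ᵐ[polydiscMeasure n α] fun z => ∏ j, f j (z j) := by
  have h := ae_all_iff.2 fun j => ae_apply hα j (hf j)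
  filter_upwards [(memLp_two_prod hα fun j => Lp.memLp (g j)).coeFn_toLp, h] with z h1 h2
  rw [tensorLp, h1]
  exact Finset.prod_congr rfl fun j _ => h2 j

theorem inner_tensorLp {α : ℝ} (hα : -1 < α) (a b : Fin n → Lp ℂ 2 (discMeasure α)) :
    inner ℂ (tensorLp hα a) (tensorLp hα b) = ∏ j, inner ℂ (a j) (b j) := by
  have := isFiniteMeasure_discMeasure hα
  rw [← integral_mul_conj_eq_inner (coeFn_tensorLp hα fun j => Filter.EventuallyEq.rfl)
    (coeFn_tensorLp hα fun j => Filter.EventuallyEq.rfl)]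
  simp only [map_prod, ← Finset.prod_mul_distrib]
  rw [polydiscMeasure_eq_pi hα, integral_fintype_prod_eq_prod
    (f := fun j z => (b j) z * (starRingEnd ℂ) ((a j) z))]
  exact Finset.prod_congr rfl fun j _ =>
    integral_mul_conj_eq_inner Filter.EventuallyEq.rfl Filter.EventuallyEq.rfl

/-- The tensor map is not linear in all arguments jointly, but expanding `‖⊗a - ⊗b‖²` leaves only
products of one-variable inner products, which are continuous in `a`. -/
theorem continuous_tensorLp {α : ℝ} (hα : -1 < α) :
    Continuous (tensorLp (n := n) hα) := by
  refine continuous_iff_continuousAt.2 fun b => ?_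
  rw [ContinuousAt, tendsto_iff_norm_sub_tendsto_zero]
  have hsq : ∀ a : Fin n → Lp ℂ 2 (discMeasure α), ‖tensorLp hα a - tensorLp hα b‖ =
      √(RCLike.re (∏ j, inner ℂ (a j) (a j) : ℂ) - 2 * RCLike.re (∏ j, inner ℂ (a j) (b j) : ℂ) +
        RCLike.re (∏ j, inner ℂ (b j) (b j) : ℂ)) := by
    intro a
    rw [← inner_tensorLp hα, ← inner_tensorLp hα, ← inner_tensorLp hα,
      inner_self_eq_norm_sq, inner_self_eq_norm_sq, ← norm_sub_sq, Real.sqrt_sq (norm_nonneg _)]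
  have hc : Continuous fun a : Fin n → Lp ℂ 2 (discMeasure α) =>
      ‖tensorLp hα a - tensorLp hα b‖ := by
    simp only [hsq]
    refine Real.continuous_sqrt.comp ?_
    refine ((RCLike.continuous_re.comp ?_).sub
      (continuous_const.mul (RCLike.continuous_re.comp ?_))).add continuous_const
    · exact continuous_finsetProd _ fun j _ => (continuous_apply j).inner (continuous_apply j)
    · exact continuous_finsetProd _ fun j _ => (continuous_apply j).inner continuous_const
  simpa using hc.tendsto b

theorem coeFn_tensorLp_update {α : ℝ} (hα : -1 < α) (g : Fin n → Lp ℂ 2 (discMeasure α))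
    (i : Fin n) {x : Lp ℂ 2 (discMeasure α)} {f : ℂ → ℂ} (hx : x =ᵐ[discMeasure α] f) :
    tensorLp hα (Function.update g i x) =ᵐ[polydiscMeasure n α] fun z =>
      (∏ j ∈ Finset.univ.erase i, g j (z j)) * f (z i) := by
  have h := coeFn_tensorLp hα (g := Function.update g i x)
    (f := Function.update (fun j => g j) i f) fun j => by
      rcases eq_or_ne j i with rfl | hj
      · simpa using hx
      · simp [hj]
  filter_upwards [h] with z hz
  rw [hz, ← Finset.prod_erase_mul _ _ (Finset.mem_univ i), Function.update_self]
  congr 1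
  exact Finset.prod_congr rfl fun j hj => by
    rw [Function.update_of_ne (Finset.ne_of_mem_erase hj)]

/-- `tensorLp` as a linear map in one of its arguments. -/
def tensorLpLinear {α : ℝ} (hα : -1 < α) (g : Fin n → Lp ℂ 2 (discMeasure α)) (i : Fin n) :
    Lp ℂ 2 (discMeasure α) →ₗ[ℂ] Lp ℂ 2 (polydiscMeasure n α) where
  toFun x := tensorLp hα (Function.update g i x)
  map_add' x y := by
    refine Lp.ext ?_
    filter_upwards [coeFn_tensorLp_update hα g i (Lp.coeFn_add x y),
      coeFn_tensorLp_update hα g i (x := x) Filter.EventuallyEq.rfl,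
      coeFn_tensorLp_update hα g i (x := y) Filter.EventuallyEq.rfl,
      Lp.coeFn_add (tensorLp hα (Function.update g i x))
        (tensorLp hα (Function.update g i y))] with z h1 h2 h3 h4
    rw [h1, h4, Pi.add_apply, Pi.add_apply, h2, h3, mul_add]
  map_smul' c x := by
    refine Lp.ext ?_
    filter_upwards [coeFn_tensorLp_update hα g i (Lp.coeFn_smul c x),
      coeFn_tensorLp_update hα g i (x := x) Filter.EventuallyEq.rfl,
      Lp.coeFn_smul c (tensorLp hα (Function.update g i x))] with z h1 h2 h4
    rw [RingHom.id_apply, h1, h4, Pi.smul_apply, Pi.smul_apply, h2, smul_eq_mul, smul_eq_mul,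
      mul_left_comm]

theorem tensorLp_mem_of_mem_closure {α : ℝ} (hα : -1 < α)
    {S : Fin n → Set (Lp ℂ 2 (discMeasure α))} {W : Submodule ℂ (Lp ℂ 2 (polydiscMeasure n α))}
    (hW : IsClosed (W : Set (Lp ℂ 2 (polydiscMeasure n α))))
    (hS : ∀ g : Fin n → Lp ℂ 2 (discMeasure α), (∀ j, g j ∈ S j) → tensorLp hα g ∈ W)
    {g : Fin n → Lp ℂ 2 (discMeasure α)}
    (hg : ∀ j, g j ∈ (Submodule.span ℂ (S j)).topologicalClosure) : tensorLp hα g ∈ W := by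
  -- Induction on the set of coordinates allowed to leave `S j` for the closed span: in one
  -- coordinate the tensor map is linear and continuous, so the preimage of `W` is a closed subspace
  -- containing `S i`.
  have key : ∀ s : Finset (Fin n), ∀ g : Fin n → Lp ℂ 2 (discMeasure α),
      (∀ j ∈ s, g j ∈ (Submodule.span ℂ (S j)).topologicalClosure) → (∀ j ∉ s, g j ∈ S j) →
      tensorLp hα g ∈ W := by
    intro s
    induction s using Finset.induction_on with
    | empty => exact fun g _ h => hS g fun j => h j (Finset.notMem_empty j)
    | insert i s hi ih =>
      intro g h1 h2
      have hle : (Submodule.span ℂ (S i)).topologicalClosure ≤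
          W.comap (tensorLpLinear hα g i) := by
        refine Submodule.topologicalClosure_minimal _ (Submodule.span_le.2 fun x hx => ?_)
          (hW.preimage ((continuous_tensorLp hα).comp
            (continuous_const.update i continuous_id)))
        refine ih (Function.update g i x) (fun j hj => ?_) fun j hj => ?_
        · have hji : j ≠ i := fun e => hi (e ▸ hj)
          rw [Function.update_of_ne hji]
          exact h1 j (Finset.mem_insert_of_mem hj)
        · rcases eq_or_ne j i with rfl | hji
          · rwa [Function.update_self]
          · rw [Function.update_of_ne hji]
            exact h2 j (by simp [hji, hj])
      have := hle (h1 i (Finset.mem_insert_self i s))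
      simpa [tensorLpLinear] using this
  exact key Finset.univ g (fun j _ => hg j) fun j hj => absurd (Finset.mem_univ j) hj

/-! ### Polynomials -/

theorem IsPolyanalyticPolynomial.smul_add {q : Fin n → ℕ} {p r : (Fin n → ℂ) → ℂ} (a : ℂ)
    (hp : IsPolyanalyticPolynomial q p) (hr : IsPolyanalyticPolynomial q r) :
    IsPolyanalyticPolynomial q (a • p + r) := by
  obtain ⟨hp1, P, hP⟩ := hp
  obtain ⟨hr1, R, hR⟩ := hr
  exact ⟨hp1.smul_add a hr1, MvPolynomial.C a * P + R, fun z => by simp [hP, hR]⟩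

theorem isPolyanalyticPolynomial_zero (q : Fin n → ℕ) : IsPolyanalyticPolynomial q 0 :=
  ⟨IsPolyanalytic.zero q, 0, fun z => by simp⟩

theorem isPolyanalyticPolynomial_monomial {q k : Fin n → ℕ} (hk : ∀ j, k j < q j)
    (m : Fin n → ℕ) :
    IsPolyanalyticPolynomial q fun z => ∏ j, discMonomial (k j) (m j) (z j) :=
  ⟨isPolyanalytic_prod fun j => isDiscPolyanalytic_discMonomial (hk j) (m j),
    ∏ j, MvPolynomial.X (Sum.inl j) ^ m j * MvPolynomial.X (Sum.inr j) ^ k j, fun z => by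
      simp [discMonomial]⟩

theorem IsPolyanalyticPolynomial.mem_bergman {α : ℝ} (hα : -1 < α) {q : Fin n → ℕ}
    {p : (Fin n → ℂ) → ℂ} (hp : IsPolyanalyticPolynomial q p) : p ∈ bergman α q := by
  have := isFiniteMeasure_polydiscMeasure (n := n) hα
  obtain ⟨hp1, P, hP⟩ := hp
  have hc : Continuous p := by
    rw [funext hP]
    refine (MvPolynomial.continuous_eval P).comp (continuous_pi ?_)
    rintro (j | j)
    · exact continuous_apply j
    · exact continuous_conj.comp (continuous_apply j)
  obtain ⟨C, hC⟩ := (isCompact_closedPolydisc n 1).exists_bound_of_continuousOn hc.continuousOn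
  refine ⟨hp1, MemLp.of_bound hc.aestronglyMeasurable C ((ae_mem_polydisc n α).mono fun z hz => ?_)⟩
  exact hC z fun j _ => mem_closedBall_zero_iff.2 (hz j).le

/-- The span in `L²` of the polyanalytic monomials. -/
def monomialSpan (α : ℝ) (q : Fin n → ℕ) : Submodule ℂ (Lp ℂ 2 (polydiscMeasure n α)) :=
  Submodule.span ℂ {F | ∃ k m : Fin n → ℕ, (∀ j, k j < q j) ∧
    F =ᵐ[polydiscMeasure n α] fun z => ∏ j, discMonomial (k j) (m j) (z j)}

theorem monomialSpan_subset_polynomialsL2 (α : ℝ) (q : Fin n → ℕ) :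
    (monomialSpan α q : Set (Lp ℂ 2 (polydiscMeasure n α))) ⊆ polynomialsL2 α q := by
  intro F hF
  induction hF using Submodule.span_induction with
  | mem F hF =>
    obtain ⟨k, m, hk, hF⟩ := hF
    exact ⟨_, isPolyanalyticPolynomial_monomial hk m, hF⟩
  | zero => exact ⟨0, isPolyanalyticPolynomial_zero q, Lp.coeFn_zero _ _ _⟩
  | add F G _ _ hF hG =>
    obtain ⟨p, hp, hF⟩ := hF
    obtain ⟨r, hr, hG⟩ := hG
    refine ⟨p + r, by simpa using hp.smul_add 1 hr, (Lp.coeFn_add F G).trans (hF.add hG)⟩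
  | smul a F _ hF =>
    obtain ⟨p, hp, hF⟩ := hF
    exact ⟨a • p, by simpa using hp.smul_add a (isPolyanalyticPolynomial_zero q),
      (Lp.coeFn_smul a F).trans (hF.const_smul a)⟩

theorem polynomialsL2_subset_bergmanL2 {α : ℝ} (hα : -1 < α) (q : Fin n → ℕ) :
    polynomialsL2 α q ⊆ (bergmanL2 α q : Set (Lp ℂ 2 (polydiscMeasure n α))) :=
  fun _ ⟨p, hp, hF⟩ => ⟨p, hp.mem_bergman hα, hF⟩

/-! ### Product kernels -/

/-- A slice of a member is polyanalytic, and when square integrable it belongs to the one-variable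
space, where `K j` reproduces it; this is exactly the input of `eq_integral_prod_of_separately`. -/
theorem isBergmanKernel_prod {α : ℝ} (hα : -1 < α) {q : Fin n → ℕ} {K : Fin n → ℂ → ℂ → ℂ}
    (hK : ∀ j, IsDiscBergmanKernel α (q j) (K j)) :
    IsBergmanKernel α q (fun z w => ∏ j, K j (z j) (w j)) := by
  have := isFiniteMeasure_discMeasure hα
  intro w hw
  have hKm : ∀ j, (fun z => K j z (w j)) ∈ discBergman α (q j) := fun j => (hK j (w j) (hw j)).1
  have hmem : (fun z : Fin n → ℂ => ∏ j, K j (z j) (w j)) ∈ bergman α q :=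
    ⟨isPolyanalytic_prod (g := fun j z => K j z (w j)) fun j => (hKm j).1,
      memLp_two_prod hα (g := fun j z => K j z (w j)) fun j => (hKm j).2⟩
  refine ⟨hmem, fun f hf => ?_⟩
  replace hf : f ∈ bergman α q := hf
  have hfL := hf.2
  rw [polydiscMeasure_eq_pi hα] at hfL ⊢
  have h := eq_integral_prod_of_separately (fun _ => discMeasure α) (fun _ => disc)
    (fun j t => (starRingEnd ℂ) (K j t (w j))) w f (fun _ => ae_mem_disc α) hw
    (fun j => (hKm j).2.star) hfL
    fun j z hz hL => (hK j (w j) (hw j)).2 _ ⟨hf.1.slice hz j, hL⟩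
  simpa only [map_prod] using h

/-- Testing each kernel on the other gives `L z w = conj (K w z)` for every reproducing kernel `L`,
including `K` itself. -/
theorem IsReproducingKernel.eq {X : Type*} [MeasurableSpace X] {ν : Measure X} {Ω : Set X}
    {A : Set (X → ℂ)} {K R : X → X → ℂ} (hK : IsReproducingKernel ν Ω A K)
    (hR : IsReproducingKernel ν Ω A R) {z w : X} (hz : z ∈ Ω) (hw : w ∈ Ω) : R z w = K z w := by
  have symm : ∀ {L : X → X → ℂ}, IsReproducingKernel ν Ω A L →
      L z w = (starRingEnd ℂ) (K w z) := by
    intro L hL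
    rw [(hK z hz).2 _ (hL w hw).1, (hL w hw).2 _ (hK z hz).1, ← integral_conj]
    simp [mul_comm]
  rw [symm hR, symm hK]

theorem bergmanL2_eq_closure {α : ℝ} (hα : -1 < α) (q : Fin n → ℕ) :
    (bergmanL2 α q : Set (Lp ℂ 2 (polydiscMeasure n α))) = closure (polynomialsL2 α q) := by
  refine Set.Subset.antisymm (fun F hFb => ?_)
    (closure_minimal (polynomialsL2_subset_bergmanL2 hα q) (isClosed_bergmanL2 hα q))
  set W := (monomialSpan α q).topologicalClosure with hW
  have hWclosed : IsClosed (W : Set (Lp ℂ 2 (polydiscMeasure n α))) :=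
    Submodule.isClosed_topologicalClosure _
  have : CompleteSpace W := hWclosed.completeSpace_coe
  have hWb : W ≤ bergmanL2 α q := Submodule.topologicalClosure_minimal _
    (fun _ h => polynomialsL2_subset_bergmanL2 hα q (monomialSpan_subset_polynomialsL2 α q h))
    (isClosed_bergmanL2 hα q)
  set H := F - W.starProjection F
  have hHW : H ∈ Wᗮ := Submodule.sub_starProjection_mem_orthogonal F
  obtain ⟨h, hh, hHh⟩ : H ∈ bergmanL2 α q :=
    (bergmanL2 α q).sub_mem hFb (hWb (Submodule.starProjection_apply_mem _ _))
  choose K hK using fun j => exists_isDiscBergmanKernel hα (q j)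
  -- The value `h w` is an inner product with a product of one-variable kernels. Each factor is a
  -- limit of combinations of monomials on the disc, so the product lies in `W`, to which `H` is
  -- orthogonal.
  have hzero : ∀ w ∈ polydisc n, h w = 0 := by
    intro w hw
    have hKm := fun j => (hK j (w j) (hw j)).1
    rw [(isBergmanKernel_prod hα hK w hw).2 h hh,
      integral_mul_conj_eq_inner hHh (coeFn_tensorLp hα fun j => (hKm j).2.coeFn_toLp)]
    refine (Submodule.mem_orthogonal _ _).1 hHW _
      (tensorLp_mem_of_mem_closure hα (S := fun j => discMonomials α (q j)) hWclosed
        (fun g hg => ?_) fun j => toLp_mem_closure_discMonomials hα (hKm j))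
    choose k hk m hkm using hg
    exact Submodule.le_topologicalClosure _
      (Submodule.subset_span ⟨k, m, hk, coeFn_tensorLp hα hkm⟩)
  have hH0 : H = 0 := by
    refine Lp.ext (hHh.trans ?_)
    filter_upwards [ae_mem_polydisc n α, Lp.coeFn_zero ℂ 2 (polydiscMeasure n α)] with z hz h0
    rw [h0]
    exact hzero z hz
  have hFW : F ∈ W := by
    rw [sub_eq_zero.1 hH0]
    exact Submodule.starProjection_apply_mem _ _
  exact closure_mono (monomialSpan_subset_polynomialsL2 α q) hFW

end PolyBergman

end

theorem theoremD (n : ℕ) (α : ℝ) (hα : -1 < α) (q : Fin n → ℕ) (hq : ∀ j, 1 ≤ q j) :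
    CompleteSpace (PolyBergman.bergmanL2 α q) ∧
    (PolyBergman.bergmanL2 α q : Set (Lp ℂ 2 (PolyBergman.polydiscMeasure n α))) =
      closure (PolyBergman.polynomialsL2 α q) ∧
    (∃ K : Fin n → ℂ → ℂ → ℂ, ∀ j, PolyBergman.IsDiscBergmanKernel α (q j) (K j)) ∧
    ∀ K : Fin n → ℂ → ℂ → ℂ, (∀ j, PolyBergman.IsDiscBergmanKernel α (q j) (K j)) →
      PolyBergman.IsBergmanKernel α q (fun z w => ∏ j, K j (z j) (w j)) ∧
      ∀ R : (Fin n → ℂ) → (Fin n → ℂ) → ℂ, PolyBergman.IsBergmanKernel α q R →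
        ∀ z ∈ PolyBergman.polydisc n, ∀ w ∈ PolyBergman.polydisc n,
          R z w = ∏ j, K j (z j) (w j) := by
  refine ⟨PolyBergman.completeSpace_bergmanL2 hα q, PolyBergman.bergmanL2_eq_closure hα q, ?_,
    fun K hK => ?_⟩
  · choose K hK using fun j => PolyBergman.exists_isDiscBergmanKernel hα (q j)
    exact ⟨K, hK⟩
  · have h := PolyBergman.isBergmanKernel_prod hα hK
    exact ⟨h, fun R hR z hz w hw => PolyBergman.IsReproducingKernel.eq h hR hz hw⟩
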